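/- Let $\mathcal B_1\subset\mathbb R^2$ be the disc of radius $1$ centred at the origin, $r=|\vec r|$, and let $\Omega_0>0$. For $\varepsilon>0$ put $\Omega(\varepsilon)=\Omega_0/\varepsilon$ and consider the Gross–Pitaevskii functional $$\mathcal E^{\mathrm{GP}}[\Psi]=\int_{\mathcal B_1}d\vec r\,\Big\{|\nabla\Psi|^2-\Omega(\varepsilon)\,\Psi^*L\Psi+\frac{|\Psi|^4}{\varepsilon^2}\Big\},\qquad L=-i\,\partial/\partial\vartheta,$$ on $\{\Psi\in H^1(\mathcal B_1;\mathbb C):\|\Psi\|_{L^2(\mathcal B_1)}=1\}$. Here $\partial/\partial\vartheta$ is the angular derivative, and no boundary condition is imposed. Define $$\rho^{\mathrm{TF}}(r)=\begin{cases}\dfrac1\pi-\dfrac{\Omega_0^2}{16}(1-2r^2)&\text{if }\Omega_0\le 4/\sqrt\pi,\\[2mm]\Big[\dfrac{\Omega_0^2}{8}(r^2-1)+\dfrac{\Omega_0}{2\sqrt\pi}\Big]_+&\text{if }\Omega_0>4/\sqrt\pi,\end{cases}$$ where $[\,\cdot\,]_+$ is the positive part. Then: 1. $\rho^{\mathrm{TF}}$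 is the unique minimizer (up to null sets) of the Thomas–Fermi functional $\mathcal E^{\mathrm{TF}}[\rho]=\int_{\mathcal B_1}d\vec r\,\{\rho^2-\tfrac14\Omega_0^2r^2\rho\}$ over all $\rho\in L^2(\mathcal B_1)$ with $\rho\ge0$ and $\int_{\mathcal B_1}\rho=1$. 2. If $\Omega_0>4/\sqrt\pi$, then $\rho^{\mathrm{TF}}$ has a hole: with $R_0=\sqrt{1-\frac{4}{\sqrt\pi\,\Omega_0}}\in(0,1)$, a point of $\mathcal B_1$ satisfies $\rho^{\mathrm{TF}}(r)=0$ if and only if $r\le R_0$. 3. There are constants $C>0$ and $\varepsilon_0>0$, depending only on $\Omega_0$, such that for every $0<\varepsilon<\varepsilon_0$ every minimizer $\Psi^{\mathrm{GP}}_\varepsilon$ of $\mathcal E^{\mathrm{GP}}$ satisfies $$\big\|\,|\Psi^{\mathrm{GP}}_\varepsilon|^2-\rho^{\mathrm{TF}}\big\|_{L^1(\mathcal B_1)}\le C\sqrt{\varepsilon\,|\log\varepsilon|}.$$ -/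

import Mathlib

open MeasureTheory Set
open scoped ContDiff ENNReal

noncomputable section

/-- The plane `ℝ²` with its Euclidean norm. -/
abbrev Plane : Type := EuclideanSpace ℝ (Fin 2)

/-- The disc of radius one centred at the origin. -/
def disc : Set Plane := Metric.ball 0 1

/-- `G 0`, `G 1` are the weak partial derivatives of `Ψ` on the disc: for every smooth test function
`φ` with compact support in the disc, `∫ (∂ᵢ φ) Ψ = - ∫ φ (G i)`. -/
def IsWeakGradient (Ψ : Plane → ℂ) (G : Fin 2 → Plane → ℂ) : Prop :=
  ∀ φ : Plane → ℝ, ContDiff ℝ ∞ φ → HasCompactSupport φ → tsupport φ ⊆ disc →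
    ∀ i : Fin 2,
      ∫ x in disc, (fderiv ℝ φ x (EuclideanSpace.single i 1)) • Ψ x
        = - ∫ x in disc, φ x • G i x

/-- `Ψ` belongs to the Sobolev space `H¹` of the disc and `G` is its weak gradient (which is
determined by `Ψ` up to null sets): `Ψ` and both components of `G` are square integrable. -/
structure IsH1 (Ψ : Plane → ℂ) (G : Fin 2 → Plane → ℂ) : Prop where
  memLp : MemLp Ψ 2 (volume.restrict disc)
  memLp_gradient : ∀ i, MemLp (G i) 2 (volume.restrict disc)
  isWeakGradient : IsWeakGradient Ψ G

/-- `L Ψ = -i ∂Ψ/∂ϑ = -i (x₁ ∂₂ Ψ - x₂ ∂₁ Ψ)`, where `G` is the weak gradient of `Ψ`. -/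
def angularMomentum (G : Fin 2 → Plane → ℂ) (x : Plane) : ℂ :=
  -Complex.I * ((x 0 : ℂ) * G 1 x - (x 1 : ℂ) * G 0 x)

/-- The Gross-Pitaevskii energy `∫ { |∇Ψ|² - Ω Ψ* L Ψ + |Ψ|⁴ / ε² }` over the disc, for `Ψ` in `H¹`
with weak gradient `G`. `∫ Ψ* L Ψ` is real because `L` is symmetric, so that only the real part of
the integrand contributes. The nonnegative quartic term is integrated with values in `[0, ∞]`, so
that no default value of an integral can enter (it is finite on `H¹`). -/
def gpEnergy (Ω ε : ℝ) (Ψ : Plane → ℂ) (G : Fin 2 → Plane → ℂ) : EReal :=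
  ((∫ x in disc, (‖G 0 x‖ ^ 2 + ‖G 1 x‖ ^ 2
      - Ω * (starRingEnd ℂ (Ψ x) * angularMomentum G x).re) : ℝ) : EReal)
    + ((∫⁻ x in disc, ENNReal.ofReal (‖Ψ x‖ ^ 4 / ε ^ 2) : ℝ≥0∞) : EReal)

/-- `Ψ` minimizes the Gross-Pitaevskii energy among all `H¹` functions on the disc whose
`L²` norm is one. -/
def IsGPMinimizer (Ω ε : ℝ) (Ψ : Plane → ℂ) : Prop :=
  ∃ G : Fin 2 → Plane → ℂ, IsH1 Ψ G ∧ ∫ x in disc, ‖Ψ x‖ ^ 2 = 1 ∧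
    ∀ (Φ : Plane → ℂ) (H : Fin 2 → Plane → ℂ), IsH1 Φ H → ∫ x in disc, ‖Φ x‖ ^ 2 = 1 →
      gpEnergy Ω ε Ψ G ≤ gpEnergy Ω ε Φ H

/-- The Thomas-Fermi functional `∫ { ρ² - Ω₀² r² ρ / 4 }` over the disc. -/
def tfEnergy (Ω₀ : ℝ) (ρ : Plane → ℝ) : ℝ :=
  ∫ x in disc, (ρ x ^ 2 - Ω₀ ^ 2 * ‖x‖ ^ 2 * ρ x / 4)

/-- Nonnegative square integrable densities on the disc of total mass one. -/
structure IsTFDensity (ρ : Plane → ℝ) : Prop where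
  memLp : MemLp ρ 2 (volume.restrict disc)
  nonneg : ∀ᵐ x ∂(volume.restrict disc), 0 ≤ ρ x
  mass : ∫ x in disc, ρ x = 1

/-- `ρ` minimizes the Thomas-Fermi functional among the densities of total mass one. -/
def IsTFMinimizer (Ω₀ : ℝ) (ρ : Plane → ℝ) : Prop :=
  IsTFDensity ρ ∧ ∀ σ : Plane → ℝ, IsTFDensity σ → tfEnergy Ω₀ ρ ≤ tfEnergy Ω₀ σ

open Classical in
/-- The explicit Thomas-Fermi density `ρ^TF`. -/
def rhoTF (Ω₀ : ℝ) (x : Plane) : ℝ :=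
  if Ω₀ ≤ 4 / √Real.pi then
    1 / Real.pi - Ω₀ ^ 2 / 16 * (1 - 2 * ‖x‖ ^ 2)
  else
    max (Ω₀ ^ 2 / 8 * (‖x‖ ^ 2 - 1) + Ω₀ / (2 * √Real.pi)) 0

/-- The radius of the hole of the Thomas-Fermi density, for `Ω₀ > 4 / √π`. -/
def holeRadius (Ω₀ : ℝ) : ℝ := √(1 - 4 / (√Real.pi * Ω₀))

end

open scoped Topology

/-! ### The Thomas-Fermi problem -/

/-! With the vector potential `A = (Ω/2)(-x₂, x₁)`, completing the square turns the Gross–Pitaevskii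
energy into `∫ |(∇ - iA)Ψ|²` plus the Thomas–Fermi energy of `|Ψ|²` divided by `ε²`
(`IsH1.gpEnergy_eq`). The first term is nonnegative. The second is quadratic: among densities of
mass one, the Thomas–Fermi excess dominates the squared `L²` distance to `rhoTF`
(`integral_sq_sub_rhoTF_le`). This gives minimality and uniqueness of `rhoTF`. It also reduces the
last claim to an upper bound: a trial state of energy at most `TF/ε² + O(|log ε|/ε)` forces every
minimizer to have squared `L²` distance `O(ε|log ε|)`, hence `L¹` distance of the order of its root.

The trial state (`exists_trialState`) is a normalized product of a Lipschitz amplitude `√(rhoTF +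
ε)` and a phase-like factor `v = w/√(|w|² + ε)`. Here `w` is an explicit vortex lattice of spacing
`ℓ ~ √ε` whose covariant gradient is `O(1/ℓ)` although `A` itself is of size `1/ε`. With `h =
1/(|w|² + ε)`, the covariant derivatives of `v` have square `O(h/ε)`, and `1 - |v|² = εh`. Both
errors are therefore governed by `∫ h`, which is `O(|log ε|)` because `|w|²` is bounded below by a
function with isolated quadratic zeros (`setIntegral_disc_inv_vortexLattice_le`). -/

theorem isOpen_disc : IsOpen disc := Metric.isOpen_ball

theorem measurableSet_disc : MeasurableSet disc := isOpen_disc.measurableSet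

theorem norm_lt_one_of_mem_disc {x : Plane} (hx : x ∈ disc) : ‖x‖ < 1 := by
  simpa [disc] using hx

theorem volume_disc : volume disc = ENNReal.ofReal Real.pi := by
  rw [disc, EuclideanSpace.volume_ball_fin_two]; simp [← NNReal.coe_real_pi]

instance isFiniteMeasure_restrict_disc : IsFiniteMeasure (volume.restrict disc) :=
  ⟨by rw [Measure.restrict_apply_univ, volume_disc]; exact ENNReal.ofReal_lt_top⟩

theorem volume_real_disc : volume.real disc = Real.pi := by
  rw [Measure.real, volume_disc, ENNReal.toReal_ofReal Real.pi_pos.le]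

theorem Continuous.integrableOn_disc {E : Type*} [NormedAddCommGroup E] {f : Plane → E}
    (hf : Continuous f) : IntegrableOn f disc :=
  (hf.continuousOn.integrableOn_compact (isCompact_closedBall 0 1)).mono_set
    Metric.ball_subset_closedBall

/-- Continuous functions belong to every `L^p` space of the disc. -/
theorem Continuous.memLp_disc {E : Type*} [NormedAddCommGroup E] [SecondCountableTopology E]
    [MeasurableSpace E] [BorelSpace E] {f : Plane → E}
    (hf : Continuous f) (p : ℝ≥0∞) : MemLp f p (volume.restrict disc) := by
  obtain ⟨C, hC⟩ := (isCompact_closedBall (0 : Plane) 1).exists_bound_of_continuousOn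
    hf.continuousOn
  refine MemLp.of_bound hf.aestronglyMeasurable C ?_
  filter_upwards [ae_restrict_mem measurableSet_disc] with x hx
  exact hC x (Metric.ball_subset_closedBall hx)

theorem setIntegral_disc_norm (f : ℝ → ℝ) :
    ∫ x in disc, f ‖x‖ = 2 * Real.pi * ∫ r in (0 : ℝ)..1, r * f r := by
  have h := integral_fun_norm_addHaar (volume : Measure Plane) ((Iio (1 : ℝ)).indicator f)
  have h1 : ∫ x in disc, f ‖x‖ = ∫ x : Plane, (Iio (1 : ℝ)).indicator f ‖x‖ := by
    rw [← integral_indicator measurableSet_disc]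
    congr 1
    ext x
    simp [indicator, disc]
  have h2 : ∫ y in Ioi (0 : ℝ), y ^ (Module.finrank ℝ Plane - 1) • (Iio (1 : ℝ)).indicator f y
      = ∫ r in (0 : ℝ)..1, r * f r := by
    rw [intervalIntegral.integral_of_le zero_le_one, integral_Ioc_eq_integral_Ioo,
      ← Ioi_inter_Iio, inter_comm, ← Measure.restrict_restrict measurableSet_Iio,
      ← integral_indicator measurableSet_Iio]
    congr 1
    ext y
    simp [indicator]
  rw [h1, h, h2]
  have h3 : (volume : Measure Plane).real (Metric.ball 0 1) = Real.pi := volume_real_disc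
  rw [h3]
  simp
  ring

/-- The constant term of the Thomas-Fermi density; half its chemical potential. -/
noncomputable def tfOffset (Ω₀ : ℝ) : ℝ :=
  if Ω₀ ≤ 4 / √Real.pi then 1 / Real.pi - Ω₀ ^ 2 / 16
  else Ω₀ / (2 * √Real.pi) - Ω₀ ^ 2 / 8

theorem tfOffset_nonneg {Ω₀ : ℝ} (h0 : 0 < Ω₀) (h : Ω₀ ≤ 4 / √Real.pi) : 0 ≤ tfOffset Ω₀ := by
  rw [tfOffset, if_pos h]
  have h1 : Ω₀ ^ 2 ≤ (4 / √Real.pi) ^ 2 := by gcongr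
  rw [div_pow, Real.sq_sqrt Real.pi_pos.le] at h1
  have : (4 : ℝ) ^ 2 / Real.pi = 16 * (1 / Real.pi) := by ring
  linarith

/-- Both regimes share one formula: below the critical value the offset is nonnegative and the
positive part is inert. -/
theorem rhoTF_eq {Ω₀ : ℝ} (h0 : 0 < Ω₀) (x : Plane) :
    rhoTF Ω₀ x = max (tfOffset Ω₀ + Ω₀ ^ 2 / 8 * ‖x‖ ^ 2) 0 := by
  by_cases h : Ω₀ ≤ 4 / √Real.pi
  · have h1 := tfOffset_nonneg h0 h
    rw [max_eq_left (by positivity), rhoTF, tfOffset, if_pos h, if_pos h]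
    ring
  · rw [rhoTF, tfOffset, if_neg h, if_neg h]
    congr 1
    ring

theorem holeRadius_sq {Ω₀ : ℝ} (h0 : 0 < Ω₀) (h : 4 / √Real.pi < Ω₀) :
    0 < 1 - 4 / (√Real.pi * Ω₀) ∧ holeRadius Ω₀ ^ 2 = 1 - 4 / (√Real.pi * Ω₀) ∧
      tfOffset Ω₀ = - (Ω₀ ^ 2 / 8 * holeRadius Ω₀ ^ 2) := by
  have hs : 0 < √Real.pi := Real.sqrt_pos.2 Real.pi_pos
  have h1 : 0 < 1 - 4 / (√Real.pi * Ω₀) := by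
    rw [sub_pos, div_lt_one (by positivity)]
    rwa [div_lt_iff₀' hs] at h
  have h2 : holeRadius Ω₀ ^ 2 = 1 - 4 / (√Real.pi * Ω₀) := Real.sq_sqrt h1.le
  refine ⟨h1, h2, ?_⟩
  rw [h2, tfOffset, if_neg h.not_ge]
  field_simp
  ring

theorem holeRadius_mem {Ω₀ : ℝ} (h0 : 0 < Ω₀) (h : 4 / √Real.pi < Ω₀) :
    0 < holeRadius Ω₀ ∧ holeRadius Ω₀ < 1 := by
  obtain ⟨h1, h2, -⟩ := holeRadius_sq h0 h
  have hs : 0 < √Real.pi := Real.sqrt_pos.2 Real.pi_pos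
  refine ⟨Real.sqrt_pos.2 h1, ?_⟩
  have h3 : 0 < 4 / (√Real.pi * Ω₀) := by positivity
  have h4 : 0 ≤ holeRadius Ω₀ := Real.sqrt_nonneg _
  rw [← sq_lt_one_iff₀ h4]
  linarith

theorem rhoTF_eq_zero_iff {Ω₀ : ℝ} (h0 : 0 < Ω₀) (h : 4 / √Real.pi < Ω₀) (x : Plane) :
    rhoTF Ω₀ x = 0 ↔ ‖x‖ ≤ holeRadius Ω₀ := by
  obtain ⟨-, -, h3⟩ := holeRadius_sq h0 h
  rw [rhoTF_eq h0, max_eq_right_iff, h3,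
    ← pow_le_pow_iff_left₀ (norm_nonneg x) (holeRadius_mem h0 h).1.le two_ne_zero,
    ← mul_le_mul_iff_right₀ (show 0 < Ω₀ ^ 2 / 8 by positivity) (b := ‖x‖ ^ 2)]
  constructor <;> intro <;> linarith

theorem continuous_rhoTF {Ω₀ : ℝ} (h0 : 0 < Ω₀) : Continuous (rhoTF Ω₀) := by
  rw [funext (rhoTF_eq h0)]
  fun_prop

theorem rhoTF_nonneg {Ω₀ : ℝ} (h0 : 0 < Ω₀) (x : Plane) : 0 ≤ rhoTF Ω₀ x := by
  rw [rhoTF_eq h0]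
  exact le_max_right _ _

theorem integral_rhoTF {Ω₀ : ℝ} (h0 : 0 < Ω₀) : ∫ x in disc, rhoTF Ω₀ x = 1 := by
  simp_rw [rhoTF_eq h0]
  rw [setIntegral_disc_norm (fun r => max (tfOffset Ω₀ + Ω₀ ^ 2 / 8 * r ^ 2) 0)]
  have hpi := Real.pi_pos
  have hs : 0 < √Real.pi := Real.sqrt_pos.2 hpi
  have key : ∀ a b : ℝ, ∫ r in a..b, r * (tfOffset Ω₀ + Ω₀ ^ 2 / 8 * r ^ 2)
      = tfOffset Ω₀ * (b ^ 2 - a ^ 2) / 2 + Ω₀ ^ 2 / 8 * (b ^ 4 - a ^ 4) / 4 := by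
    intro a b
    rw [intervalIntegral.integral_eq_sub_of_hasDerivAt
      (f := fun r => tfOffset Ω₀ * r ^ 2 / 2 + Ω₀ ^ 2 / 8 * r ^ 4 / 4)]
    · ring
    · intro r _
      have := (((hasDerivAt_pow 2 r).const_mul (tfOffset Ω₀)).div_const 2).add
        (((hasDerivAt_pow 4 r).const_mul (Ω₀ ^ 2 / 8)).div_const 4)
      refine this.congr_deriv ?_
      norm_num
      ring
    · exact Continuous.intervalIntegrable (by fun_prop) _ _
  rcases le_or_gt Ω₀ (4 / √Real.pi) with h | h
  · have h1 := tfOffset_nonneg h0 h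
    have : ∀ r : ℝ, max (tfOffset Ω₀ + Ω₀ ^ 2 / 8 * r ^ 2) 0 = tfOffset Ω₀ + Ω₀ ^ 2 / 8 * r ^ 2 :=
      fun r => max_eq_left (by positivity)
    simp_rw [this, key]
    rw [tfOffset, if_pos h]
    field_simp
    ring
  · obtain ⟨h1, h2, h3⟩ := holeRadius_sq h0 h
    obtain ⟨hR0, hR1⟩ := holeRadius_mem h0 h
    have hc : Continuous fun r : ℝ => r * max (tfOffset Ω₀ + Ω₀ ^ 2 / 8 * r ^ 2) 0 := by fun_prop
    rw [← intervalIntegral.integral_add_adjacent_intervals (b := holeRadius Ω₀)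
      (hc.intervalIntegrable _ _) (hc.intervalIntegrable _ _)]
    have e1 : ∫ r in (0 : ℝ)..holeRadius Ω₀, r * max (tfOffset Ω₀ + Ω₀ ^ 2 / 8 * r ^ 2) 0 = 0 := by
      rw [intervalIntegral.integral_congr (g := fun _ => 0), intervalIntegral.integral_zero]
      intro r hr
      rw [uIcc_of_le hR0.le] at hr
      have : Ω₀ ^ 2 / 8 * r ^ 2 ≤ Ω₀ ^ 2 / 8 * holeRadius Ω₀ ^ 2 := by
        have := hr.1
        have := hr.2
        gcongr
      change r * max (tfOffset Ω₀ + Ω₀ ^ 2 / 8 * r ^ 2) 0 = 0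
      rw [max_eq_right (by linarith), mul_zero]
    have e2 : ∫ r in holeRadius Ω₀..1, r * max (tfOffset Ω₀ + Ω₀ ^ 2 / 8 * r ^ 2) 0
        = ∫ r in holeRadius Ω₀..1, r * (tfOffset Ω₀ + Ω₀ ^ 2 / 8 * r ^ 2) := by
      refine intervalIntegral.integral_congr fun r hr => ?_
      rw [uIcc_of_le hR1.le] at hr
      have : Ω₀ ^ 2 / 8 * holeRadius Ω₀ ^ 2 ≤ Ω₀ ^ 2 / 8 * r ^ 2 := by
        have := hr.1
        gcongr
      change r * max (tfOffset Ω₀ + Ω₀ ^ 2 / 8 * r ^ 2) 0 = _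
      rw [max_eq_left (by linarith)]
    have e3 : holeRadius Ω₀ ^ 4 = (1 - 4 / (√Real.pi * Ω₀)) ^ 2 := by rw [← h2]; ring
    rw [e1, e2, key, h3, e3, h2]
    have hsq : √Real.pi ^ 2 = Real.pi := Real.sq_sqrt hpi.le
    field_simp
    rw [hsq]
    ring_nf
    rw [hsq]
    ring

theorem isTFDensity_rhoTF {Ω₀ : ℝ} (h0 : 0 < Ω₀) : IsTFDensity (rhoTF Ω₀) :=
  ⟨(continuous_rhoTF h0).memLp_disc 2, ae_of_all _ (rhoTF_nonneg h0), integral_rhoTF h0⟩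

theorem integrableOn_tfEnergy {ρ : Plane → ℝ} (hρ : MemLp ρ 2 (volume.restrict disc)) (Ω₀ : ℝ) :
    IntegrableOn (fun x => ρ x ^ 2 - Ω₀ ^ 2 * ‖x‖ ^ 2 * ρ x / 4) disc := by
  refine hρ.integrable_sq.sub ?_
  have h1 : MemLp (fun x : Plane => Ω₀ ^ 2 * ‖x‖ ^ 2 / 4) 2 (volume.restrict disc) :=
    Continuous.memLp_disc (by fun_prop) 2
  refine (h1.integrable_mul hρ).congr (ae_of_all _ fun x => ?_)
  simp only [Pi.mul_apply]
  ring

/-- Here `2 * tfOffset Ω₀` is the Lagrange multiplier of the mass constraint. Where the positive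
part is inactive this is an equality; in the hole the two sides differ by `-2s(tfOffset + Ω₀²r²/8) ≥
0`. -/
theorem sq_sub_rhoTF_le {Ω₀ s : ℝ} (h0 : 0 < Ω₀) (hs : 0 ≤ s) (x : Plane) :
    (s - rhoTF Ω₀ x) ^ 2 ≤ (s ^ 2 - Ω₀ ^ 2 * ‖x‖ ^ 2 * s / 4)
      - (rhoTF Ω₀ x ^ 2 - Ω₀ ^ 2 * ‖x‖ ^ 2 * rhoTF Ω₀ x / 4)
      - 2 * tfOffset Ω₀ * (s - rhoTF Ω₀ x) := by
  rw [rhoTF_eq h0]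
  rcases le_total 0 (tfOffset Ω₀ + Ω₀ ^ 2 / 8 * ‖x‖ ^ 2) with h | h
  · rw [max_eq_left h]
    nlinarith
  · rw [max_eq_right h]
    nlinarith [mul_nonneg hs (neg_nonneg.2 h)]

theorem integral_sq_sub_rhoTF_le {Ω₀ : ℝ} (h0 : 0 < Ω₀) {σ : Plane → ℝ} (hσ : IsTFDensity σ) :
    ∫ x in disc, (σ x - rhoTF Ω₀ x) ^ 2 ≤ tfEnergy Ω₀ σ - tfEnergy Ω₀ (rhoTF Ω₀) := by
  have hρ := isTFDensity_rhoTF h0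
  have i1 := integrableOn_tfEnergy hσ.memLp Ω₀
  have i2 := integrableOn_tfEnergy hρ.memLp Ω₀
  have i3 : IntegrableOn σ disc := hσ.memLp.integrable one_le_two
  have i4 : IntegrableOn (rhoTF Ω₀) disc := hρ.memLp.integrable one_le_two
  have i5 : IntegrableOn (fun x => 2 * tfOffset Ω₀ * (σ x - rhoTF Ω₀ x)) disc :=
    (i3.sub i4).const_mul _
  have i6 : IntegrableOn (fun x => (σ x ^ 2 - Ω₀ ^ 2 * ‖x‖ ^ 2 * σ x / 4)
      - (rhoTF Ω₀ x ^ 2 - Ω₀ ^ 2 * ‖x‖ ^ 2 * rhoTF Ω₀ x / 4)) disc := i1.sub i2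
  have e : tfEnergy Ω₀ σ - tfEnergy Ω₀ (rhoTF Ω₀) = ∫ x in disc,
      ((σ x ^ 2 - Ω₀ ^ 2 * ‖x‖ ^ 2 * σ x / 4)
      - (rhoTF Ω₀ x ^ 2 - Ω₀ ^ 2 * ‖x‖ ^ 2 * rhoTF Ω₀ x / 4)
      - 2 * tfOffset Ω₀ * (σ x - rhoTF Ω₀ x)) := by
    -- The multiplier term integrates to zero since both densities have mass one.
    rw [integral_sub i6 i5, integral_sub i1 i2, integral_const_mul, integral_sub i3 i4,
      hσ.mass, hρ.mass]
    simp [tfEnergy]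
  rw [e]
  refine integral_mono_ae (hσ.memLp.sub hρ.memLp).integrable_sq (i6.sub i5) ?_
  filter_upwards [hσ.nonneg] with x hx using sq_sub_rhoTF_le h0 hx x

theorem isTFMinimizer_rhoTF {Ω₀ : ℝ} (h0 : 0 < Ω₀) : IsTFMinimizer Ω₀ (rhoTF Ω₀) := by
  refine ⟨isTFDensity_rhoTF h0, fun σ hσ => ?_⟩
  have h1 := integral_sq_sub_rhoTF_le h0 hσ
  have h2 : 0 ≤ ∫ x in disc, (σ x - rhoTF Ω₀ x) ^ 2 := integral_nonneg fun x => sq_nonneg _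
  linarith

theorem IsTFMinimizer.ae_eq_rhoTF {Ω₀ : ℝ} (h0 : 0 < Ω₀) {ρ : Plane → ℝ}
    (h : IsTFMinimizer Ω₀ ρ) : ρ =ᵐ[volume.restrict disc] rhoTF Ω₀ := by
  have h1 := integral_sq_sub_rhoTF_le h0 h.1
  have h2 := h.2 _ (isTFDensity_rhoTF h0)
  have h3 : ∫ x in disc, (ρ x - rhoTF Ω₀ x) ^ 2 = 0 :=
    le_antisymm (by linarith) (integral_nonneg fun x => sq_nonneg _)
  have i : IntegrableOn (fun x => (ρ x - rhoTF Ω₀ x) ^ 2) disc :=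
    (h.1.memLp.sub (isTFDensity_rhoTF h0).memLp).integrable_sq
  rw [integral_eq_zero_iff_of_nonneg (fun x => sq_nonneg _) i] at h3
  filter_upwards [h3] with x hx
  exact sub_eq_zero.1 (pow_eq_zero_iff two_ne_zero |>.1 hx)

/-! ### A lattice of vortices -/


/-- The `C¹` bump `cos² (π t / 2)` on `[-1, 1]`; its integer translates sum to one. -/
noncomputable def cosBump (t : ℝ) : ℝ := if |t| ≤ 1 then Real.cos (Real.pi * t / 2) ^ 2 else 0

/-- The derivative of `cosBump`. -/
noncomputable def cosBumpDeriv (t : ℝ) : ℝ :=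
  -(Real.pi / 2 * Real.sin (Real.pi * max (-1) (min t 1)))

theorem cosBump_nonneg (t : ℝ) : 0 ≤ cosBump t := by
  unfold cosBump; split_ifs <;> positivity

theorem cosBump_le_one (t : ℝ) : cosBump t ≤ 1 := by
  unfold cosBump; split_ifs
  · exact Real.cos_sq_le_one _
  · exact zero_le_one

theorem cosBump_of_one_le {t : ℝ} (h : 1 ≤ |t|) : cosBump t = 0 := by
  rcases h.eq_or_lt with h | h
  · rw [cosBump, if_pos h.ge]
    rcases (abs_eq zero_le_one).1 h.symm with rfl | rfl
    · simp
    · simp [neg_div]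
  · rw [cosBump, if_neg h.not_ge]

theorem cosBumpDeriv_of_one_le {t : ℝ} (h : 1 ≤ |t|) : cosBumpDeriv t = 0 := by
  rcases le_abs.1 h with h | h
  · simp [cosBumpDeriv, min_eq_right h]
  · simp [cosBumpDeriv, min_eq_left (by linarith : t ≤ 1), max_eq_left (by linarith : t ≤ -1)]

theorem abs_cosBumpDeriv_le (t : ℝ) : |cosBumpDeriv t| ≤ Real.pi / 2 := by
  rw [cosBumpDeriv, abs_neg, abs_mul, abs_of_pos (by positivity)]
  exact mul_le_of_le_one_right (by positivity) (Real.abs_sin_le_one _)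

theorem continuous_cosBumpDeriv : Continuous cosBumpDeriv := by
  unfold cosBumpDeriv; fun_prop

/-- Only `|t| = 1` is delicate: a squared cosine vanishes there to second order, so it glues to zero
with derivative zero. -/
theorem hasDerivAt_cosBump (t : ℝ) : HasDerivAt cosBump (cosBumpDeriv t) t := by
  rcases lt_trichotomy |t| 1 with h | h | h
  · have h1 : HasDerivAt (fun t : ℝ => Real.cos (Real.pi * t / 2) ^ 2) (cosBumpDeriv t) t := by
      have h2 := ((((hasDerivAt_id t).const_mul Real.pi).div_const 2).cos).pow 2
      refine h2.congr_deriv ?_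
      have h3 := abs_lt.1 h
      rw [cosBumpDeriv, min_eq_left h3.2.le, max_eq_right h3.1.le,
        show Real.pi * t = 2 * (Real.pi * t / 2) by ring, Real.sin_two_mul]
      simp only [id, Nat.cast_ofNat, Nat.add_one_sub_one, pow_one]
      ring
    refine h1.congr_of_eventuallyEq ?_
    filter_upwards [(continuous_abs.tendsto t).eventually (gt_mem_nhds h)] with s hs
    rw [cosBump, if_pos hs.le]
  · rw [cosBumpDeriv_of_one_le h.ge, hasDerivAt_iff_isLittleO]
    refine Asymptotics.IsBigO.trans_isLittleO (g := fun s => ‖s - t‖ ^ 2) ?_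
      (Asymptotics.isLittleO_pow_sub_sub t one_lt_two)
    refine Asymptotics.IsBigO.of_bound ((Real.pi / 2) ^ 2) (Filter.Eventually.of_forall fun s => ?_)
    rw [cosBump_of_one_le h.ge, smul_zero, sub_zero, sub_zero, Real.norm_eq_abs,
      abs_of_nonneg (cosBump_nonneg s), Real.norm_eq_abs, Real.norm_eq_abs, sq_abs,
      abs_of_nonneg (sq_nonneg _), ← mul_pow]
    unfold cosBump
    split_ifs
    · have h1 : Real.cos (Real.pi * s / 2) ^ 2 = Real.sin (Real.pi / 2 * (s - t)) ^ 2 := by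
        rcases (abs_eq zero_le_one).1 h with rfl | rfl
        · rw [show Real.pi / 2 * (s - 1) = Real.pi * s / 2 - Real.pi / 2 by ring,
            Real.sin_sub_pi_div_two, neg_sq]
        · rw [show Real.pi / 2 * (s - -1) = Real.pi * s / 2 + Real.pi / 2 by ring,
            Real.sin_add_pi_div_two]
      rw [h1]
      exact sq_le_sq.2 Real.abs_sin_le_abs
    · positivity
  · rw [cosBumpDeriv_of_one_le h.le]
    refine (hasDerivAt_const t (0 : ℝ)).congr_of_eventuallyEq ?_
    filter_upwards [(continuous_abs.tendsto t).eventually (lt_mem_nhds h)] with s hs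
    rw [cosBump_of_one_le hs.le]

theorem contDiff_cosBump : ContDiff ℝ 1 cosBump := by
  rw [contDiff_one_iff_deriv]
  refine ⟨fun t => (hasDerivAt_cosBump t).differentiableAt, ?_⟩
  rw [show deriv cosBump = cosBumpDeriv from funext fun t => (hasDerivAt_cosBump t).deriv]
  exact continuous_cosBumpDeriv

/-- A sum over integers of terms supported at distance less than one of `t` has two terms. -/
theorem sum_eq_floor_add {M : Type*} [AddCommMonoid M] {t : ℝ} {N : ℕ} (hN : |t| + 1 ≤ N)
    {F : ℤ → M} (hF : ∀ n : ℤ, 1 ≤ |t - n| → F n = 0) :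
    ∑ n ∈ Finset.Icc (-(N : ℤ)) N, F n = F ⌊t⌋ + F (⌊t⌋ + 1) := by
  rw [← Finset.sum_pair (f := F) (show ⌊t⌋ ≠ ⌊t⌋ + 1 by omega)]
  symm
  have h1 := Int.floor_le t
  have h2 := Int.lt_floor_add_one t
  have h3 := le_abs_self t
  have h4 := neg_abs_le t
  refine Finset.sum_subset ?_ ?_
  · intro n hn
    have e1 : -(N : ℤ) ≤ ⌊t⌋ := Int.le_floor.2 (by push_cast; linarith)
    have e2 : ⌊t⌋ + 1 ≤ (N : ℤ) := by
      have : (⌊t⌋ : ℝ) + 1 ≤ (N : ℝ) := by linarith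
      exact_mod_cast this
    simp only [Finset.mem_insert, Finset.mem_singleton] at hn
    rw [Finset.mem_Icc]
    omega
  · intro n _ hn
    simp only [Finset.mem_insert, Finset.mem_singleton, not_or] at hn
    refine hF n ?_
    rcases lt_or_ge n ⌊t⌋ with h | h
    · have : (n : ℝ) + 1 ≤ ⌊t⌋ := by exact_mod_cast h
      rw [le_abs]; left; linarith
    · have : (⌊t⌋ : ℝ) + 2 ≤ n := by
        have : ⌊t⌋ + 2 ≤ n := by omega
        exact_mod_cast this
      rw [le_abs]; right; linarith

/-- A function with one simple zero in every cell of a square lattice of side `ℓ`, which satisfies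
magnetic quasi-periodicity conditions in the symmetric gauge if `Ω ℓ² = 2 π`. -/
noncomputable def vortexLattice (Ω ℓ : ℝ) (N : ℕ) (a b : ℝ) : ℂ :=
  ∑ n ∈ Finset.Icc (-(N : ℤ)) N, (cosBump (a / ℓ - n) : ℂ)
    * Complex.exp (((2 * Real.pi * n * b / ℓ - Ω * a * b / 2 : ℝ) : ℂ) * Complex.I)

theorem contDiff_vortexLattice (Ω ℓ : ℝ) (N : ℕ) :
    ContDiff ℝ 1 fun x : Plane => vortexLattice Ω ℓ N (x 0) (x 1) := by
  unfold vortexLattice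
  refine ContDiff.sum fun n _ => ContDiff.mul ?_ ?_
  · exact Complex.ofRealCLM.contDiff.comp (contDiff_cosBump.comp (by fun_prop))
  · refine Complex.contDiff_exp.comp (ContDiff.mul ?_ contDiff_const)
    have : ContDiff ℝ 1 fun x : Plane => 2 * Real.pi * n * x 1 / ℓ - Ω * x 0 * x 1 / 2 := by
      fun_prop
    exact Complex.ofRealCLM.contDiff.comp this

/-- Differentiating the common phase `exp(-iΩab/2)` produces exactly the first component of `iA`.
What remains comes from the derivatives of the two bumps that overlap at `a`. -/
theorem exists_hasDerivAt_vortexLattice_fst {Ω ℓ : ℝ} (hℓ : 0 < ℓ) {N : ℕ} {a : ℝ}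
    (hN : |a / ℓ| + 1 ≤ N) (b : ℝ) :
    ∃ d : ℂ, HasDerivAt (fun s => vortexLattice Ω ℓ N s b) d a ∧
      ‖d - Complex.I * ((-(Ω / 2 * b) : ℝ) : ℂ) * vortexLattice Ω ℓ N a b‖ ≤ 4 * Real.pi / ℓ := by
  have h : HasDerivAt (fun s => vortexLattice Ω ℓ N s b)
      (∑ n ∈ Finset.Icc (-(N : ℤ)) N, (((cosBumpDeriv (a / ℓ - n) / ℓ : ℝ) : ℂ)
        * Complex.exp (((2 * Real.pi * n * b / ℓ - Ω * a * b / 2 : ℝ) : ℂ) * Complex.I)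
        + (cosBump (a / ℓ - n) : ℂ)
        * (Complex.exp (((2 * Real.pi * n * b / ℓ - Ω * a * b / 2 : ℝ) : ℂ) * Complex.I)
          * (((-(Ω * b / 2) : ℝ) : ℂ) * Complex.I)))) a := by
    unfold vortexLattice
    refine HasDerivAt.fun_sum fun n _ => HasDerivAt.mul ?_ ?_
    · refine HasDerivAt.ofReal_comp ?_
      have := (hasDerivAt_cosBump (a / ℓ - n)).comp a
        (((hasDerivAt_id a).div_const ℓ).sub_const (n : ℝ))
      refine this.congr_deriv ?_
      ring
    · refine (HasDerivAt.mul_const (HasDerivAt.ofReal_comp ?_) _).cexp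
      refine ((((hasDerivAt_id a).const_mul Ω).mul_const b).div_const 2
        |>.const_sub (2 * Real.pi * n * b / ℓ)).congr_deriv ?_
      ring
  refine ⟨_, h, ?_⟩
  have e : (∑ n ∈ Finset.Icc (-(N : ℤ)) N, (((cosBumpDeriv (a / ℓ - n) / ℓ : ℝ) : ℂ)
        * Complex.exp (((2 * Real.pi * n * b / ℓ - Ω * a * b / 2 : ℝ) : ℂ) * Complex.I)
        + (cosBump (a / ℓ - n) : ℂ)
        * (Complex.exp (((2 * Real.pi * n * b / ℓ - Ω * a * b / 2 : ℝ) : ℂ) * Complex.I)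
          * (((-(Ω * b / 2) : ℝ) : ℂ) * Complex.I))))
      - Complex.I * ((-(Ω / 2 * b) : ℝ) : ℂ) * vortexLattice Ω ℓ N a b
      = ∑ n ∈ Finset.Icc (-(N : ℤ)) N, (((cosBumpDeriv (a / ℓ - n) / ℓ : ℝ) : ℂ)
        * Complex.exp (((2 * Real.pi * n * b / ℓ - Ω * a * b / 2 : ℝ) : ℂ) * Complex.I)) := by
    rw [vortexLattice, Finset.mul_sum, ← Finset.sum_sub_distrib]
    refine Finset.sum_congr rfl fun n _ => ?_
    push_cast
    ring
  rw [e, sum_eq_floor_add hN fun n hn => by rw [cosBumpDeriv_of_one_le hn]; simp]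
  have hb : ∀ t θ : ℝ, ‖((cosBumpDeriv t / ℓ : ℝ) : ℂ) * Complex.exp (θ * Complex.I)‖
      ≤ Real.pi / 2 / ℓ := by
    intro t θ
    rw [norm_mul, Complex.norm_exp_ofReal_mul_I, mul_one, Complex.norm_real, Real.norm_eq_abs,
      abs_div, abs_of_pos hℓ]
    gcongr
    exact abs_cosBumpDeriv_le t
  refine (norm_add_le_of_le (hb _ _) (hb _ _)).trans ?_
  rw [← add_div]
  gcongr
  linarith [Real.pi_pos]

/-- After `iA` is subtracted, the `n`-th phase contributes `2πn/ℓ - Ωa`, which is `-(2π/ℓ)(a/ℓ - n)`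
because `Ωℓ² = 2π`. This is at most `2π/ℓ` on the support of the `n`-th bump, although `Ωa` alone is
of order `1/ℓ²`. -/
theorem exists_hasDerivAt_vortexLattice_snd {Ω ℓ : ℝ} (hℓ : 0 < ℓ) (hΩ : Ω = 2 * Real.pi / ℓ ^ 2)
    {N : ℕ} {a : ℝ} (hN : |a / ℓ| + 1 ≤ N) (b : ℝ) :
    ∃ d : ℂ, HasDerivAt (fun s => vortexLattice Ω ℓ N a s) d b ∧
      ‖d - Complex.I * ((Ω / 2 * a : ℝ) : ℂ) * vortexLattice Ω ℓ N a b‖ ≤ 4 * Real.pi / ℓ := by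
  have h : HasDerivAt (fun s => vortexLattice Ω ℓ N a s)
      (∑ n ∈ Finset.Icc (-(N : ℤ)) N, (cosBump (a / ℓ - n) : ℂ)
        * (Complex.exp (((2 * Real.pi * n * b / ℓ - Ω * a * b / 2 : ℝ) : ℂ) * Complex.I)
          * (((2 * Real.pi * n / ℓ - Ω * a / 2 : ℝ) : ℂ) * Complex.I))) b := by
    unfold vortexLattice
    refine HasDerivAt.fun_sum fun n _ => HasDerivAt.const_mul _ ?_
    refine (HasDerivAt.mul_const (HasDerivAt.ofReal_comp ?_) _).cexp
    refine ((((hasDerivAt_id b).const_mul (2 * Real.pi * n)).div_const ℓ).sub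
      (((hasDerivAt_id b).const_mul (Ω * a)).div_const 2)).congr_deriv ?_
    ring
  refine ⟨_, h, ?_⟩
  have e : (∑ n ∈ Finset.Icc (-(N : ℤ)) N, (cosBump (a / ℓ - n) : ℂ)
        * (Complex.exp (((2 * Real.pi * n * b / ℓ - Ω * a * b / 2 : ℝ) : ℂ) * Complex.I)
          * (((2 * Real.pi * n / ℓ - Ω * a / 2 : ℝ) : ℂ) * Complex.I)))
      - Complex.I * ((Ω / 2 * a : ℝ) : ℂ) * vortexLattice Ω ℓ N a b
      = ∑ n ∈ Finset.Icc (-(N : ℤ)) N,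
        ((cosBump (a / ℓ - n) * (-(2 * Real.pi / ℓ * (a / ℓ - n))) : ℝ) : ℂ)
        * (Complex.exp (((2 * Real.pi * n * b / ℓ - Ω * a * b / 2 : ℝ) : ℂ) * Complex.I)
          * Complex.I) := by
    rw [vortexLattice, Finset.mul_sum, ← Finset.sum_sub_distrib]
    refine Finset.sum_congr rfl fun n _ => ?_
    have : -(2 * Real.pi / ℓ * (a / ℓ - n)) = 2 * Real.pi * n / ℓ - Ω * a := by
      rw [hΩ]
      field_simp
      ring
    rw [this]
    push_cast
    ring
  rw [e, sum_eq_floor_add hN fun n hn => by rw [cosBump_of_one_le hn]; simp]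
  have hb : ∀ t θ : ℝ, |t| ≤ 1 → ‖((cosBump t * (-(2 * Real.pi / ℓ * t)) : ℝ) : ℂ)
      * (Complex.exp (θ * Complex.I) * Complex.I)‖ ≤ 2 * Real.pi / ℓ := by
    intro t θ ht
    have hp : 0 < 2 * Real.pi / ℓ := by positivity
    rw [norm_mul, norm_mul, Complex.norm_exp_ofReal_mul_I, Complex.norm_I, mul_one, mul_one,
      Complex.norm_real, Real.norm_eq_abs, abs_mul, abs_neg, abs_mul, abs_of_pos hp,
      abs_of_nonneg (cosBump_nonneg t)]
    calc cosBump t * (2 * Real.pi / ℓ * |t|) ≤ 1 * (2 * Real.pi / ℓ * 1) := by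
          gcongr
          exact cosBump_le_one t
      _ = _ := by ring
  have h1 := Int.floor_le (a / ℓ)
  have h2 := Int.lt_floor_add_one (a / ℓ)
  refine (norm_add_le_of_le (hb _ _ ?_) (hb _ _ ?_)).trans ?_
  · rw [abs_le]; constructor <;> linarith
  · push_cast
    rw [abs_le]; constructor <;> linarith
  · rw [← add_div]
    gcongr
    linarith [Real.pi_pos]

/-- Two overlapping waves cancel only if their amplitudes agree and their phases are opposite; this
is what confines the zeros of the lattice to isolated points. -/
theorem norm_sq_exp_combination (p q θ φ : ℝ) :
    ‖(p : ℂ) * Complex.exp (θ * Complex.I) + (q : ℂ) * Complex.exp (φ * Complex.I)‖ ^ 2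
      = (p - q) ^ 2 + 4 * p * q * Real.cos ((φ - θ) / 2) ^ 2 := by
  have h : Real.cos (φ - θ) = 2 * Real.cos ((φ - θ) / 2) ^ 2 - 1 := by
    rw [← Real.cos_two_mul]; ring_nf
  have h1 := Real.sin_sq_add_cos_sq θ
  have h2 := Real.sin_sq_add_cos_sq φ
  rw [Real.cos_sub] at h
  rw [← Complex.normSq_eq_norm_sq, Complex.normSq_apply]
  simp [Complex.exp_ofReal_mul_I_re, Complex.exp_ofReal_mul_I_im]
  linear_combination p ^ 2 * h1 + q ^ 2 * h2 + 2 * p * q * h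

/-- The vortex lattice vanishes at most where `cos² (π a / ℓ) + cos² (π b / ℓ)` does. -/
theorem cos_sq_add_cos_sq_le_norm_vortexLattice {Ω ℓ : ℝ} (hℓ : 0 < ℓ) {N : ℕ} {a : ℝ}
    (hN : |a / ℓ| + 1 ≤ N) (b : ℝ) :
    (Real.cos (Real.pi * (a / ℓ)) ^ 2 + Real.cos (Real.pi * (b / ℓ)) ^ 2) / 2
      ≤ ‖vortexLattice Ω ℓ N a b‖ ^ 2 := by
  rw [vortexLattice, sum_eq_floor_add hN fun n hn => by rw [cosBump_of_one_le hn]; simp,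
    norm_sq_exp_combination]
  set n := ⌊a / ℓ⌋ with hn
  have h1 : (n : ℝ) ≤ a / ℓ := Int.floor_le (a / ℓ)
  have h2 : a / ℓ < n + 1 := Int.lt_floor_add_one (a / ℓ)
  set t := a / ℓ - n with ht
  have e1 : cosBump t = Real.cos (Real.pi * t / 2) ^ 2 := by
    rw [cosBump, if_pos]
    rw [abs_le]; constructor <;> linarith
  have e2 : cosBump (a / ℓ - ((n + 1 : ℤ) : ℝ)) = Real.sin (Real.pi * t / 2) ^ 2 := by
    rw [cosBump, if_pos]
    · rw [← Real.cos_sub_pi_div_two, ht]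
      push_cast
      ring_nf
    · push_cast
      rw [abs_le]; constructor <;> linarith
  have e3 : (2 * Real.pi * ((n + 1 : ℤ) : ℝ) * b / ℓ - Ω * a * b / 2
      - (2 * Real.pi * (n : ℝ) * b / ℓ - Ω * a * b / 2)) / 2 = Real.pi * (b / ℓ) := by
    push_cast
    field_simp
    ring
  have e4 : Real.cos (Real.pi * (a / ℓ)) ^ 2 = Real.cos (Real.pi * t) ^ 2 := by
    have : Real.pi * (a / ℓ) = Real.pi * t + n * Real.pi := by rw [ht]; ring
    rw [this, Real.cos_add_int_mul_pi, mul_pow]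
    have : (((-1 : ℝ) ^ n) ^ 2) = 1 := by
      rw [← zpow_natCast, ← zpow_mul, mul_comm, zpow_mul]; simp
    rw [this, one_mul]
  rw [e1, e2, e3, e4]
  have c1 : Real.cos (Real.pi * t) = Real.cos (Real.pi * t / 2) ^ 2
      - Real.sin (Real.pi * t / 2) ^ 2 := by
    rw [← Real.cos_two_mul']; ring_nf
  have c2 : Real.sin (Real.pi * t) ^ 2 = 4 * Real.cos (Real.pi * t / 2) ^ 2
      * Real.sin (Real.pi * t / 2) ^ 2 := by
    rw [show Real.pi * t = 2 * (Real.pi * t / 2) by ring, Real.sin_two_mul]; ring_nf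
  rw [← c1, ← c2, Real.sin_sq]
  have u1 := Real.cos_sq_le_one (Real.pi * t)
  have u2 := Real.cos_sq_le_one (Real.pi * (b / ℓ))
  -- With `C` and `c` the two squared cosines, the squared modulus is `C + (1 - C)c = C + c - Cc`,
  -- and `Cc ≤ (C + c)/2` as both lie in `[0, 1]`.
  nlinarith [sq_nonneg (Real.cos (Real.pi * t)), sq_nonneg (Real.cos (Real.pi * (b / ℓ))),
    mul_nonneg (sq_nonneg (Real.cos (Real.pi * t))) (sub_nonneg.2 u2),
    mul_nonneg (sq_nonneg (Real.cos (Real.pi * (b / ℓ)))) (sub_nonneg.2 u1)]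

/-- Dividing by a regularized modulus changes the covariant derivative by a bounded factor. -/
theorem exists_hasDerivAt_normalized {γ : ℝ → ℂ} {γ' : ℂ} {s ε : ℝ} (h : HasDerivAt γ γ' s)
    (hε : 0 < ε) (A : ℝ) :
    ∃ d : ℂ, HasDerivAt (fun t => (√(‖γ t‖ ^ 2 + ε))⁻¹ • γ t) d s ∧
      ‖d - Complex.I * (A : ℂ) * ((√(‖γ s‖ ^ 2 + ε))⁻¹ • γ s)‖
        ≤ 2 * ‖γ' - Complex.I * (A : ℂ) * γ s‖ / √(‖γ s‖ ^ 2 + ε) := by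
  have hpos : 0 < ‖γ s‖ ^ 2 + ε := by positivity
  have hP : 0 < √(‖γ s‖ ^ 2 + ε) := Real.sqrt_pos.2 hpos
  have h1 := (((h.norm_sq).add_const ε).sqrt hpos.ne').inv hP.ne'
  refine ⟨_, h1.smul h, ?_⟩
  set P := √(‖γ s‖ ^ 2 + ε) with hPdef
  set D := γ' - Complex.I * (A : ℂ) * γ s with hD
  -- The magnetic term is orthogonal to `γ` for the real inner product, so the derivative of the
  -- modulus sees only the covariant derivative `D`.
  have hin : inner ℝ (γ s) γ' = inner ℝ (γ s) D := by
    rw [hD, inner_sub_right]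
    have : inner ℝ (γ s) (Complex.I * (A : ℂ) * γ s) = 0 := by
      rw [Complex.inner]
      simp
      ring
    rw [this, sub_zero]
  have hsq : P ^ 2 = ‖γ s‖ ^ 2 + ε := Real.sq_sqrt hpos.le
  have e : (fun t => (√(‖γ t‖ ^ 2 + ε))⁻¹) s • γ'
      + (-(2 * inner ℝ (γ s) γ' / (2 * P)) / P ^ 2) • γ s
      - Complex.I * (A : ℂ) * (P⁻¹ • γ s) = P⁻¹ • D - (inner ℝ (γ s) D / P ^ 3) • γ s := by
    rw [← hin, hD]
    simp only [Complex.real_smul, ← hPdef]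
    have : (P : ℂ) ≠ 0 := by exact_mod_cast hP.ne'
    push_cast
    field_simp
    ring
  refine (congrArg norm e).trans_le ?_
  refine (norm_sub_le _ _).trans ?_
  rw [norm_smul, norm_smul, norm_inv, norm_div, Real.norm_eq_abs, Real.norm_eq_abs, norm_pow,
    Real.norm_eq_abs, abs_of_pos hP]
  have hc := abs_real_inner_le_norm (γ s) D
  have : |inner ℝ (γ s) D| / P ^ 3 * ‖γ s‖ ≤ ‖D‖ / P := by
    rw [div_mul_eq_mul_div, div_le_div_iff₀ (by positivity) hP]
    calc |inner ℝ (γ s) D| * ‖γ s‖ * P ≤ (‖γ s‖ * ‖D‖) * ‖γ s‖ * P := by gcongr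
      _ = ‖D‖ * (‖γ s‖ ^ 2 * P) := by ring
      _ ≤ ‖D‖ * (P ^ 2 * P) :=
        mul_le_mul_of_nonneg_left (mul_le_mul_of_nonneg_right (by linarith) hP.le) (norm_nonneg _)
      _ = _ := by ring
  calc P⁻¹ * ‖D‖ + |inner ℝ (γ s) D| / P ^ 3 * ‖γ s‖ ≤ P⁻¹ * ‖D‖ + ‖D‖ / P := by gcongr
    _ = _ := by ring

/-! ### The integral of the reciprocal of the squared modulus of the vortex lattice -/

/-- The rescaled interval is covered by `2⌈1/ℓ⌉` periods, and `ℓ⌈1/ℓ⌉ ≤ 1 + ℓ ≤ 2`; the bound is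
thus uniform in `ℓ`. -/
theorem integral_periodic_rescaled_le {k : ℝ → ℝ} (hk : Continuous k) (h0 : ∀ t, 0 ≤ k t)
    (hp : Function.Periodic k 1) {ℓ : ℝ} (hℓ : 0 < ℓ) (hℓ1 : ℓ ≤ 1) :
    ∫ x in (-1 : ℝ)..1, k (x / ℓ) ≤ 4 * ∫ x in (0 : ℝ)..1, k x := by
  have hI : 0 ≤ ∫ x in (0 : ℝ)..1, k x :=
    intervalIntegral.integral_nonneg zero_le_one fun x _ => h0 x
  set M : ℕ := ⌈1 / ℓ⌉₊ with hM
  have h1 : 1 / ℓ ≤ M := Nat.le_ceil _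
  have h2 : (M : ℝ) < 1 / ℓ + 1 := Nat.ceil_lt_add_one (by positivity)
  rw [intervalIntegral.integral_comp_div k hℓ.ne', smul_eq_mul]
  have h3 : ∫ x in (-1 / ℓ)..(1 / ℓ), k x ≤ ∫ x in (-(M : ℝ))..M, k x := by
    refine intervalIntegral.integral_mono_interval ?_ ?_ h1 (ae_of_all _ h0)
      (hk.intervalIntegrable _ _)
    · rw [neg_div]; linarith
    · rw [neg_div]; linarith [show 0 < 1 / ℓ by positivity]
  have h4 : ∫ x in (-(M : ℝ))..M, k x = (2 * M) * ∫ x in (0 : ℝ)..1, k x := by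
    have := hp.intervalIntegral_add_zsmul_eq (2 * M : ℤ) (-(M : ℝ))
      fun _ _ => hk.intervalIntegrable _ _
    rw [hp.intervalIntegral_add_eq (-(M : ℝ)) 0, zero_add] at this
    simp only [zsmul_eq_mul, mul_one] at this
    push_cast at this
    rw [show -(M : ℝ) + 2 * M = M by ring] at this
    exact this
  calc ℓ * ∫ x in (-1 / ℓ)..(1 / ℓ), k x ≤ ℓ * ((2 * M) * ∫ x in (0 : ℝ)..1, k x) := by
        rw [← h4]; gcongr
    _ = (2 * (ℓ * M)) * ∫ x in (0 : ℝ)..1, k x := by ring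
    _ ≤ 4 * ∫ x in (0 : ℝ)..1, k x := by
        refine mul_le_mul_of_nonneg_right ?_ hI
        have : ℓ * M ≤ ℓ * (1 / ℓ + 1) := by gcongr
        rw [mul_add, mul_one_div_cancel hℓ.ne'] at this
        linarith

/-- Jordan's inequality for the sine, centred at the zero `1/2` of the cosine. -/
theorem four_mul_sq_le_cos_sq {y : ℝ} (hy : y ∈ Icc (0 : ℝ) 1) :
    4 * (y - 1 / 2) ^ 2 ≤ Real.cos (Real.pi * y) ^ 2 := by
  have h1 : Real.cos (Real.pi * y) ^ 2 = Real.sin (Real.pi * (y - 1 / 2)) ^ 2 := by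
    rw [show Real.pi * (y - 1 / 2) = Real.pi * y - Real.pi / 2 by ring, Real.sin_sub_pi_div_two,
      neg_sq]
  have h2 : |Real.pi * (y - 1 / 2)| ≤ Real.pi / 2 := by
    have h : |y - 1 / 2| ≤ 1 / 2 := by rw [abs_le]; constructor <;> linarith [hy.1, hy.2]
    rw [abs_mul, abs_of_pos Real.pi_pos]
    nlinarith [mul_le_mul_of_nonneg_left h Real.pi_pos.le]
  have h3 := Real.mul_abs_le_abs_sin h2
  rw [abs_mul, abs_of_pos Real.pi_pos, ← mul_assoc, div_mul_cancel₀ _ Real.pi_pos.ne'] at h3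
  rw [h1, show 4 * (y - 1 / 2) ^ 2 = (2 * |y - 1 / 2|) ^ 2 by rw [mul_pow, sq_abs]; ring,
    ← sq_abs (Real.sin _)]
  gcongr

theorem integral_inv_cos_sq_add_sq_le {s : ℝ} (hs : 0 < s) :
    ∫ y in (0 : ℝ)..1, (Real.cos (Real.pi * y) ^ 2 + s ^ 2)⁻¹ ≤ Real.pi / (2 * s) := by
  have hc : Continuous fun y : ℝ => (Real.cos (Real.pi * y) ^ 2 + s ^ 2)⁻¹ :=
    Continuous.inv₀ (by fun_prop) fun y => by positivity
  have hd : Continuous fun y : ℝ => (4 * (y - 1 / 2) ^ 2 + s ^ 2)⁻¹ :=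
    Continuous.inv₀ (by fun_prop) fun y => by positivity
  have h1 : ∫ y in (0 : ℝ)..1, (4 * (y - 1 / 2) ^ 2 + s ^ 2)⁻¹
      = (Real.arctan (1 / s) - Real.arctan (-1 / s)) / (2 * s) := by
    rw [intervalIntegral.integral_eq_sub_of_hasDerivAt
      (f := fun y => Real.arctan (2 * (y - 1 / 2) / s) / (2 * s)) _ (hd.intervalIntegrable _ _)]
    · norm_num
      ring
    · intro y _
      have := (((((hasDerivAt_id y).sub_const (1 / 2)).const_mul 2).div_const s).arctan).div_const
        (2 * s)
      refine this.congr_deriv ?_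
      simp only [id]
      field_simp
      ring
  calc ∫ y in (0 : ℝ)..1, (Real.cos (Real.pi * y) ^ 2 + s ^ 2)⁻¹
      ≤ ∫ y in (0 : ℝ)..1, (4 * (y - 1 / 2) ^ 2 + s ^ 2)⁻¹ := by
        refine intervalIntegral.integral_mono_on zero_le_one (hc.intervalIntegrable _ _)
          (hd.intervalIntegrable _ _) fun y hy => ?_
        have := four_mul_sq_le_cos_sq hy
        gcongr
    _ = (Real.arctan (1 / s) - Real.arctan (-1 / s)) / (2 * s) := h1
    _ ≤ Real.pi / (2 * s) := by
        gcongr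
        linarith [Real.arctan_lt_pi_div_two (1 / s), Real.neg_pi_div_two_lt_arctan (-1 / s)]

theorem integral_inv_sqrt_cos_sq_add_le {δ : ℝ} (hδ : 0 < δ) :
    ∫ y in (0 : ℝ)..1, (√(Real.cos (Real.pi * y) ^ 2 + δ))⁻¹ ≤ Real.arsinh (1 / √δ) := by
  have hc : Continuous fun y : ℝ => (√(Real.cos (Real.pi * y) ^ 2 + δ))⁻¹ :=
    Continuous.inv₀ (by fun_prop) fun y => by positivity
  have hd : Continuous fun y : ℝ => (√(4 * (y - 1 / 2) ^ 2 + δ))⁻¹ :=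
    Continuous.inv₀ (by fun_prop) fun y => by positivity
  have hs : 0 < √δ := Real.sqrt_pos.2 hδ
  have h1 : ∫ y in (0 : ℝ)..1, (√(4 * (y - 1 / 2) ^ 2 + δ))⁻¹ = Real.arsinh (1 / √δ) := by
    rw [intervalIntegral.integral_eq_sub_of_hasDerivAt
      (f := fun y => Real.arsinh (2 * (y - 1 / 2) / √δ) / 2) _ (hd.intervalIntegrable _ _)]
    · norm_num [neg_div]
    · intro y _
      have := (((((hasDerivAt_id y).sub_const (1 / 2)).const_mul 2).div_const (√δ)).arsinh).div_const
        2
      refine this.congr_deriv ?_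
      simp only [id]
      have : 4 * (y - 1 / 2) ^ 2 + δ = δ * (1 + (2 * (y - 1 / 2) / √δ) ^ 2) := by
        rw [div_pow, Real.sq_sqrt hδ.le]
        field_simp
        ring
      rw [this, Real.sqrt_mul hδ.le]
      have : 0 < √(1 + (2 * (y - 1 / 2) / √δ) ^ 2) := by positivity
      rw [smul_eq_mul]
      field_simp
  rw [← h1]
  refine intervalIntegral.integral_mono_on zero_le_one (hc.intervalIntegrable _ _)
    (hd.intervalIntegrable _ _) fun y hy => ?_
  have := four_mul_sq_le_cos_sq hy
  gcongr

theorem arsinh_inv_sqrt_le {ε : ℝ} (h0 : 0 < ε) (h1 : ε ≤ 1 / 2) :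
    Real.arsinh (1 / √(2 * ε)) ≤ 2 * |Real.log ε| := by
  have hl : Real.log ε ≤ 0 := Real.log_nonpos h0.le (by linarith)
  rw [abs_of_nonpos hl, Real.arsinh]
  have hs : 0 < √(2 * ε) := Real.sqrt_pos.2 (by positivity)
  have hs1 : √(2 * ε) ≤ 1 := Real.sqrt_le_one.2 (by linarith)
  have hsq : √(2 * ε) ^ 2 = 2 * ε := Real.sq_sqrt (by positivity)
  have e1 : √(1 + (1 / √(2 * ε)) ^ 2) ≤ 2 / √(2 * ε) := by
    rw [Real.sqrt_le_left (by positivity), div_pow, div_pow, hsq]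
    rw [← sub_nonneg]
    have : 2 ^ 2 / (2 * ε) - (1 + 1 ^ 2 / (2 * ε)) = (3 - 2 * ε) / (2 * ε) := by field_simp; ring
    rw [this]
    apply div_nonneg <;> linarith
  -- Any fixed power of `1/ε` would do inside the logarithm; `3/√(2ε) ≤ ε⁻²` holds already for `ε ≤
  -- 1/2`.
  have e2 : 1 / √(2 * ε) + √(1 + (1 / √(2 * ε)) ^ 2) ≤ (ε ^ 2)⁻¹ := by
    refine (add_le_add_right e1 _).trans ?_
    rw [← add_div, div_le_iff₀ hs, inv_mul_eq_div, le_div_iff₀ (by positivity)]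
    refine le_of_sq_le_sq ?_ hs.le
    rw [hsq]
    have : ε ^ 3 ≤ (1 / 2) ^ 3 := by gcongr
    nlinarith
  calc Real.log _ ≤ Real.log (ε ^ 2)⁻¹ := Real.log_le_log (by positivity) e2
    _ = 2 * -Real.log ε := by rw [Real.log_inv, Real.log_pow]; push_cast; ring

theorem setIntegral_disc_le_integral_square {F : ℝ × ℝ → ℝ} (hF : Continuous F)
    (h0 : ∀ p, 0 ≤ F p) :
    ∫ x in disc, F (x 0, x 1) ≤ ∫ a in (-1 : ℝ)..1, ∫ b in (-1 : ℝ)..1, F (a, b) := by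
  have hm : MeasurePreserving (fun x : Plane => (x 0, x 1)) := by
    have := (volume_preserving_finTwoArrow ℝ).comp
      (EuclideanSpace.volume_preserving_symm_measurableEquiv_toLp (Fin 2))
    exact this
  have hemb : MeasurableEmbedding (fun x : Plane => (x 0, x 1)) :=
    ((MeasurableEquiv.toLp 2 (Fin 2 → ℝ)).symm.trans
      MeasurableEquiv.finTwoArrow).measurableEmbedding
  have hint : IntegrableOn F (Icc (-1 : ℝ) 1 ×ˢ Icc (-1 : ℝ) 1) :=
    hF.continuousOn.integrableOn_compact (isCompact_Icc.prod isCompact_Icc)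
  have hint' : IntegrableOn F (Ioc (-1 : ℝ) 1 ×ˢ Ioc (-1 : ℝ) 1) :=
    hint.mono_set (prod_mono Ioc_subset_Icc_self Ioc_subset_Icc_self)
  have e : ∫ a in (-1 : ℝ)..1, ∫ b in (-1 : ℝ)..1, F (a, b)
      = ∫ x in (fun x : Plane => (x 0, x 1)) ⁻¹' (Ioc (-1 : ℝ) 1 ×ˢ Ioc (-1 : ℝ) 1),
        F (x 0, x 1) := by
    rw [hm.setIntegral_preimage_emb hemb F, Measure.volume_eq_prod, setIntegral_prod _ hint']
    rw [intervalIntegral.integral_of_le (by norm_num)]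
    simp_rw [intervalIntegral.integral_of_le (show (-1 : ℝ) ≤ 1 by norm_num)]
  rw [e]
  refine setIntegral_mono_set ?_ (ae_of_all _ fun x => h0 _) (LE.le.eventuallyLE ?_)
  · exact (hm.integrableOn_comp_preimage hemb).2 hint'
  · intro x hx
    have hx1 := norm_lt_one_of_mem_disc hx
    have hc : ∀ i, |x i| < 1 := fun i => (PiLp.norm_apply_le x i).trans_lt hx1
    exact ⟨⟨(abs_lt.1 (hc 0)).1, (abs_lt.1 (hc 0)).2.le⟩,
      ⟨(abs_lt.1 (hc 1)).1, (abs_lt.1 (hc 1)).2.le⟩⟩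

/-- The integrand is at most `2/(cos²(πb/ℓ) + s²)` with `s² = cos²(πa/ℓ) + 2ε`. Integrating in `b`
gives `O(1/s)`, by comparison with an arctangent; the integral of `1/s` in `a` is an `arsinh`, hence
logarithmic. Periodicity removes the dependence on `ℓ`. -/
theorem setIntegral_disc_inv_vortexLattice_le {Ω ℓ ε : ℝ} (hℓ : 0 < ℓ) (hℓ1 : ℓ ≤ 1) {N : ℕ}
    (hN : 1 / ℓ + 1 ≤ N) (hε : 0 < ε) (hε1 : ε ≤ 1 / 2) :
    ∫ x in disc, (‖vortexLattice Ω ℓ N (x 0) (x 1)‖ ^ 2 + ε)⁻¹ ≤ 32 * Real.pi * |Real.log ε| := by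
  have hF : Continuous fun p : ℝ × ℝ => 2 * (Real.cos (Real.pi * (p.2 / ℓ)) ^ 2
      + √(Real.cos (Real.pi * (p.1 / ℓ)) ^ 2 + 2 * ε) ^ 2)⁻¹ :=
    continuous_const.mul (Continuous.inv₀ (by fun_prop) fun p => by positivity)
  have hcos : Function.Periodic (fun t : ℝ => Real.cos (Real.pi * t) ^ 2) 1 := by
    intro t
    simp [mul_add, Real.cos_add_pi]
  have hc := (contDiff_vortexLattice Ω ℓ N).continuous
  have hw : Continuous fun x : Plane => (‖vortexLattice Ω ℓ N (x 0) (x 1)‖ ^ 2 + ε)⁻¹ :=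
    Continuous.inv₀ (by fun_prop) fun p => by positivity
  have hF1 : Continuous fun x : Plane => 2 * (Real.cos (Real.pi * (x 1 / ℓ)) ^ 2
      + √(Real.cos (Real.pi * (x 0 / ℓ)) ^ 2 + 2 * ε) ^ 2)⁻¹ :=
    continuous_const.mul (Continuous.inv₀ (by fun_prop) fun p => by positivity)
  have step1 : ∫ x in disc, (‖vortexLattice Ω ℓ N (x 0) (x 1)‖ ^ 2 + ε)⁻¹
      ≤ ∫ x in disc, 2 * (Real.cos (Real.pi * (x 1 / ℓ)) ^ 2
        + √(Real.cos (Real.pi * (x 0 / ℓ)) ^ 2 + 2 * ε) ^ 2)⁻¹ := by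
    refine setIntegral_mono_on hw.integrableOn_disc hF1.integrableOn_disc measurableSet_disc
      fun x hx => ?_
    have hx0 : |x 0 / ℓ| + 1 ≤ N := by
      refine le_trans ?_ hN
      rw [abs_div, abs_of_pos hℓ]
      gcongr
      exact ((PiLp.norm_apply_le x 0).trans_lt (norm_lt_one_of_mem_disc hx)).le
    have := cos_sq_add_cos_sq_le_norm_vortexLattice (Ω := Ω) hℓ hx0 (x 1)
    rw [Real.sq_sqrt (by positivity), ← inv_inv (2 : ℝ), ← mul_inv]
    gcongr
    linarith
  refine step1.trans ((setIntegral_disc_le_integral_square hF fun p => by positivity).trans ?_)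
  have hk2 : Continuous fun a : ℝ => (√(Real.cos (Real.pi * a) ^ 2 + 2 * ε))⁻¹ :=
    Continuous.inv₀ (by fun_prop) fun p => by positivity
  have step2 : ∀ a : ℝ, ∫ b in (-1 : ℝ)..1, 2 * (Real.cos (Real.pi * (b / ℓ)) ^ 2
      + √(Real.cos (Real.pi * (a / ℓ)) ^ 2 + 2 * ε) ^ 2)⁻¹
      ≤ 4 * Real.pi * (√(Real.cos (Real.pi * (a / ℓ)) ^ 2 + 2 * ε))⁻¹ := by
    intro a
    have hs : 0 < √(Real.cos (Real.pi * (a / ℓ)) ^ 2 + 2 * ε) := by positivity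
    set s := √(Real.cos (Real.pi * (a / ℓ)) ^ 2 + 2 * ε)
    have hk : Continuous fun b : ℝ => (Real.cos (Real.pi * b) ^ 2 + s ^ 2)⁻¹ :=
      Continuous.inv₀ (by fun_prop) fun p => by positivity
    have h1 := integral_periodic_rescaled_le hk (fun t => by positivity)
      (fun t => by simp only [hcos t]) hℓ hℓ1
    have h2 := integral_inv_cos_sq_add_sq_le hs
    rw [intervalIntegral.integral_const_mul]
    have h3 : 4 * Real.pi * s⁻¹ = 2 * (4 * (Real.pi / (2 * s))) := by field_simp
    rw [h3]
    linarith
  have hin : Continuous fun a : ℝ => ∫ b in (-1 : ℝ)..1, 2 * (Real.cos (Real.pi * (b / ℓ)) ^ 2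
      + √(Real.cos (Real.pi * (a / ℓ)) ^ 2 + 2 * ε) ^ 2)⁻¹ :=
    intervalIntegral.continuous_parametric_intervalIntegral_of_continuous' hF _ _
  have hk3 : Continuous fun a : ℝ =>
      4 * Real.pi * (√(Real.cos (Real.pi * (a / ℓ)) ^ 2 + 2 * ε))⁻¹ :=
    continuous_const.mul (hk2.comp (continuous_id.div_const ℓ))
  calc _ ≤ ∫ a in (-1 : ℝ)..1, 4 * Real.pi * (√(Real.cos (Real.pi * (a / ℓ)) ^ 2 + 2 * ε))⁻¹ :=
        intervalIntegral.integral_mono_on (by norm_num) (hin.intervalIntegrable _ _)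
          (hk3.intervalIntegrable _ _) fun a _ => step2 a
    _ = 4 * Real.pi * ∫ a in (-1 : ℝ)..1, (√(Real.cos (Real.pi * (a / ℓ)) ^ 2 + 2 * ε))⁻¹ :=
        intervalIntegral.integral_const_mul _ _
    _ ≤ 4 * Real.pi * (4 * (2 * |Real.log ε|)) := by
        have h1 := integral_periodic_rescaled_le hk2 (fun t => by positivity)
          (fun t => by simp only [hcos t]) hℓ hℓ1
        have h2 := (integral_inv_sqrt_cos_sq_add_le (show 0 < 2 * ε by positivity)).trans
          (arsinh_inv_sqrt_le hε hε1)
        have := Real.pi_pos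
        gcongr
        linarith
    _ = _ := by ring

/-! ### Products of a Lipschitz function and a `C¹` function belong to `H¹` -/

/-- The `C¹` factor is absorbed into the test function: `φp` is Lipschitz with compact support, so
integration by parts against the Lipschitz `g` applies, and the Leibniz rule for `φp` separates the
terms. -/
theorem integral_fderiv_mul_lipschitz_mul {g φ p : Plane → ℝ} {K : NNReal} (hg : LipschitzWith K g)
    (hφ : ContDiff ℝ 1 φ) (hφc : HasCompactSupport φ) (hp : ContDiff ℝ 1 p) (e : Plane) :
    ∫ x, fderiv ℝ φ x e * (g x * p x)
      = - ∫ x, φ x * (lineDeriv ℝ g x e * p x + g x * fderiv ℝ p x e) := by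
  have hφp : ContDiff ℝ 1 fun x => φ x * p x := hφ.mul hp
  have hφpc : HasCompactSupport fun x => φ x * p x := hφc.mul_right
  obtain ⟨D, hD⟩ := ContDiff.lipschitzWith_of_hasCompactSupport hφpc hφp one_ne_zero
  have h := LipschitzWith.integral_lineDeriv_mul_eq (μ := volume) hg hD hφpc e
  have hl : ∀ x, lineDeriv ℝ (fun x => φ x * p x) x (-e)
      = -(fderiv ℝ φ x e * p x + φ x * fderiv ℝ p x e) := by
    intro x
    have h1 := (hφ.differentiable one_ne_zero x).hasFDerivAt
    have h2 := (hp.differentiable one_ne_zero x).hasFDerivAt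
    rw [((h1.fun_mul h2).hasLineDerivAt (-e)).lineDeriv]
    simp
    ring
  simp_rw [hl] at h
  have c1 : Continuous fun x => fderiv ℝ φ x e := (hφ.continuous_fderiv one_ne_zero).clm_apply
    continuous_const
  have c2 : Continuous fun x => fderiv ℝ p x e := (hp.continuous_fderiv one_ne_zero).clm_apply
    continuous_const
  have s1 : HasCompactSupport fun x => fderiv ℝ φ x e := hφc.fderiv_apply ℝ e
  have i1 : Integrable fun x => fderiv ℝ φ x e * (g x * p x) :=
    (c1.mul (hg.continuous.mul hp.continuous)).integrable_of_hasCompactSupport s1.mul_right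
  have i2 : Integrable fun x => φ x * (g x * fderiv ℝ p x e) :=
    (hφ.continuous.mul (hg.continuous.mul c2)).integrable_of_hasCompactSupport hφc.mul_right
  have i3 : Integrable fun x => lineDeriv ℝ g x e * (φ x * p x) := by
    refine Integrable.bdd_mul (c := K * ‖e‖) (hφp.continuous.integrable_of_hasCompactSupport hφpc)
      (measurable_lineDeriv hg.continuous).aestronglyMeasurable (ae_of_all _ fun x => ?_)
    exact norm_lineDeriv_le_of_lipschitz ℝ hg
  have e1 : ∫ x, -(fderiv ℝ φ x e * p x + φ x * fderiv ℝ p x e) * g x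
      = -((∫ x, fderiv ℝ φ x e * (g x * p x)) + ∫ x, φ x * (g x * fderiv ℝ p x e)) := by
    rw [← integral_add i1 i2, ← integral_neg]
    exact integral_congr_ae (ae_of_all _ fun x => by ring)
  have e2 : ∫ x, φ x * (lineDeriv ℝ g x e * p x + g x * fderiv ℝ p x e)
      = (∫ x, lineDeriv ℝ g x e * (φ x * p x)) + ∫ x, φ x * (g x * fderiv ℝ p x e) := by
    rw [← integral_add i3 i2]
    exact integral_congr_ae (ae_of_all _ fun x => by ring)
  rw [e2, h, e1]
  ring

/-- The gradient of the product of a Lipschitz function and a `C¹` function. -/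
noncomputable def productGradient (g : Plane → ℝ) (v : Plane → ℂ) (i : Fin 2) (x : Plane) : ℂ :=
  lineDeriv ℝ g x (EuclideanSpace.single i 1) • v x
    + g x • fderiv ℝ v x (EuclideanSpace.single i 1)

theorem memLp_productGradient {g : Plane → ℝ} {K : NNReal} (hg : LipschitzWith K g)
    {v : Plane → ℂ} (hv : ContDiff ℝ 1 v) (i : Fin 2) (p : ℝ≥0∞) :
    MemLp (productGradient g v i) p (volume.restrict disc) := by
  have c2 : Continuous fun x => fderiv ℝ v x (EuclideanSpace.single i 1) :=
    (hv.continuous_fderiv one_ne_zero).clm_apply continuous_const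
  refine MemLp.add ?_ ((hg.continuous.smul c2).memLp_disc p)
  refine MemLp.of_le_mul (c := K * ‖(EuclideanSpace.single i 1 : Plane)‖)
    (hv.continuous.memLp_disc p) ?_ (ae_of_all _ fun x => ?_)
  · exact ((measurable_lineDeriv hg.continuous).aestronglyMeasurable).smul
      hv.continuous.aestronglyMeasurable
  · rw [norm_smul]
    gcongr
    exact norm_lineDeriv_le_of_lipschitz ℝ hg

theorem isH1_smul {g : Plane → ℝ} {K : NNReal} (hg : LipschitzWith K g)
    {v : Plane → ℂ} (hv : ContDiff ℝ 1 v) :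
    IsH1 (fun x => g x • v x) (productGradient g v) := by
  refine ⟨(hg.continuous.smul hv.continuous).memLp_disc 2,
    fun i => memLp_productGradient hg hv i 2, ?_⟩
  intro φ hφ hφc hφs i
  have hφ1 : ContDiff ℝ 1 φ := hφ.of_le (by exact_mod_cast le_top)
  set e : Plane := EuclideanSpace.single i 1 with he
  have z1 : ∀ x ∉ disc, φ x = 0 := fun x hx => by
    by_contra h
    exact hx (hφs (subset_tsupport φ h))
  have z2 : ∀ x ∉ disc, fderiv ℝ φ x = 0 := fun x hx => by
    by_contra h
    exact hx (hφs (support_fderiv_subset ℝ h))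
  have c1 : Continuous fun x => fderiv ℝ φ x e := (hφ1.continuous_fderiv one_ne_zero).clm_apply
    continuous_const
  have i1 : IntegrableOn (fun x => fderiv ℝ φ x e • (g x • v x)) disc :=
    (c1.smul (hg.continuous.smul hv.continuous)).integrableOn_disc
  have i2 : IntegrableOn (fun x => φ x • productGradient g v i x) disc := by
    obtain ⟨C, hC⟩ := hφc.exists_bound_of_continuous hφ.continuous
    exact Integrable.bdd_smul ((memLp_productGradient hg hv i 1).integrable le_rfl) C
      hφ.continuous.aestronglyMeasurable (ae_of_all _ hC)
  -- The integration by parts is available for real-valued functions, so the identity is tested on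
  -- real functionals; the real and imaginary parts suffice.
  have key : ∀ L : ℂ →L[ℝ] ℝ, L (∫ x in disc, fderiv ℝ φ x e • (g x • v x))
      = L (-∫ x in disc, φ x • productGradient g v i x) := by
    intro L
    have hLv : ContDiff ℝ 1 fun x => L (v x) := L.contDiff.comp hv
    have h := integral_fderiv_mul_lipschitz_mul hg hφ1 hφc hLv e
    have hd : ∀ x, fderiv ℝ (fun x => L (v x)) x e = L (fderiv ℝ v x e) := fun x => by
      have := (L.hasFDerivAt.comp x (hv.differentiable one_ne_zero x).hasFDerivAt).fderiv
      exact congrArg (fun M : Plane →L[ℝ] ℝ => M e) this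
    simp_rw [hd] at h
    rw [map_neg, ← L.integral_comp_comm i1, ← L.integral_comp_comm i2,
      setIntegral_eq_integral_of_forall_compl_eq_zero fun x hx => by simp [z2 x hx],
      setIntegral_eq_integral_of_forall_compl_eq_zero fun x hx => by simp [z1 x hx]]
    simpa only [productGradient, ← he, map_add, map_smul, smul_eq_mul] using h
  exact Complex.ext (key Complex.reCLM) (key Complex.imCLM)

/-! ### The Gross-Pitaevskii energy in terms of the magnetic gradient -/

/-- The vector potential of the homogeneous magnetic field `Ω`, in the symmetric gauge. -/
noncomputable def magneticPotential (Ω : ℝ) (i : Fin 2) (x : Plane) : ℝ :=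
  if i = 0 then -(Ω / 2 * x 1) else Ω / 2 * x 0

/-- The covariant derivative of `Ψ`, where `G` is the gradient of `Ψ`. -/
noncomputable def covariantDeriv (Ω : ℝ) (Ψ : Plane → ℂ) (G : Fin 2 → Plane → ℂ) (i : Fin 2)
    (x : Plane) : ℂ :=
  G i x - Complex.I * (magneticPotential Ω i x : ℂ) * Ψ x

/-- Expanding the covariant square, the cross term with `A` is the rotation term, and `|A|² =
Ω²r²/4`. -/
theorem norm_sq_sub_angularMomentum (Ω : ℝ) (Ψ : Plane → ℂ) (G : Fin 2 → Plane → ℂ) (x : Plane) :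
    ‖G 0 x‖ ^ 2 + ‖G 1 x‖ ^ 2 - Ω * (starRingEnd ℂ (Ψ x) * angularMomentum G x).re
      = (‖covariantDeriv Ω Ψ G 0 x‖ ^ 2 + ‖covariantDeriv Ω Ψ G 1 x‖ ^ 2)
        - Ω ^ 2 * ‖x‖ ^ 2 * ‖Ψ x‖ ^ 2 / 4 := by
  have hx : ‖x‖ ^ 2 = x 0 ^ 2 + x 1 ^ 2 := by
    rw [EuclideanSpace.norm_sq_eq]; simp
  rw [hx]
  simp only [← Complex.normSq_eq_norm_sq, Complex.normSq_apply, covariantDeriv, angularMomentum,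
    magneticPotential]
  simp
  ring

theorem continuous_magneticPotential (Ω : ℝ) (i : Fin 2) : Continuous (magneticPotential Ω i) := by
  unfold magneticPotential
  split_ifs <;> fun_prop

theorem IsH1.memLp_covariantDeriv {Ψ : Plane → ℂ} {G : Fin 2 → Plane → ℂ} (h : IsH1 Ψ G) (Ω : ℝ)
    (i : Fin 2) : MemLp (covariantDeriv Ω Ψ G i) 2 (volume.restrict disc) := by
  have hA := continuous_magneticPotential Ω i
  obtain ⟨C, hC⟩ := (isCompact_closedBall (0 : Plane) 1).exists_bound_of_continuousOn hA.continuousOn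
  refine (h.memLp_gradient i).sub (MemLp.of_le_mul (c := C) h.memLp ?_ ?_)
  · exact (Continuous.aestronglyMeasurable (by fun_prop)).mul h.memLp.1
  · filter_upwards [ae_restrict_mem measurableSet_disc] with x hx
    rw [norm_mul, norm_mul, Complex.norm_I, one_mul, Complex.norm_real]
    gcongr
    exact hC x (Metric.ball_subset_closedBall hx)

/-- Integrability of `|Ψ|⁴` comes from finite energy instead of a Sobolev embedding; a minimizer has
finite energy by comparison with the trial state. -/
theorem lintegral_norm_pow_four_ne_top {Ω ε : ℝ} {Ψ : Plane → ℂ} {G : Fin 2 → Plane → ℂ}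
    (h : gpEnergy Ω ε Ψ G ≠ ⊤) : ∫⁻ x in disc, ENNReal.ofReal (‖Ψ x‖ ^ 4 / ε ^ 2) ≠ ⊤ := by
  intro h1
  apply h
  rw [gpEnergy, h1, EReal.coe_ennreal_top, EReal.coe_add_top]

theorem IsH1.memLp_norm_sq {ε : ℝ} (hε : 0 < ε) {Ψ : Plane → ℂ} {G : Fin 2 → Plane → ℂ}
    (h : IsH1 Ψ G) (h4 : ∫⁻ x in disc, ENNReal.ofReal (‖Ψ x‖ ^ 4 / ε ^ 2) ≠ ⊤) :
    MemLp (fun x => ‖Ψ x‖ ^ 2) 2 (volume.restrict disc) := by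
  have hm : AEStronglyMeasurable (fun x => ‖Ψ x‖ ^ 2) (volume.restrict disc) := h.memLp.1.norm.pow 2
  rw [memLp_two_iff_integrable_sq hm]
  have h1 : Integrable (fun x => ‖Ψ x‖ ^ 4 / ε ^ 2) (volume.restrict disc) :=
    (lintegral_ofReal_ne_top_iff_integrable ((h.memLp.1.norm.aemeasurable.pow_const 4).div_const _).aestronglyMeasurable
      (ae_of_all _ fun x => by positivity)).1 h4
  refine (h1.mul_const (ε ^ 2)).congr (ae_of_all _ fun x => ?_)
  simp only
  field_simp

/-- For `Ω = Ω₀/ε` the centrifugal term and the quartic term both scale like `ε⁻²`, and together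
they form the Thomas–Fermi functional. -/
theorem IsH1.gpEnergy_eq {Ω₀ ε : ℝ} (hε : 0 < ε) {Ψ : Plane → ℂ} {G : Fin 2 → Plane → ℂ}
    (h : IsH1 Ψ G) (h4 : MemLp (fun x => ‖Ψ x‖ ^ 2) 2 (volume.restrict disc)) :
    gpEnergy (Ω₀ / ε) ε Ψ G
      = (((∫ x in disc, (‖covariantDeriv (Ω₀ / ε) Ψ G 0 x‖ ^ 2
          + ‖covariantDeriv (Ω₀ / ε) Ψ G 1 x‖ ^ 2))
        + tfEnergy Ω₀ (fun x => ‖Ψ x‖ ^ 2) / ε ^ 2 : ℝ) : EReal) := by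
  have i1 : IntegrableOn (fun x => ‖covariantDeriv (Ω₀ / ε) Ψ G 0 x‖ ^ 2
      + ‖covariantDeriv (Ω₀ / ε) Ψ G 1 x‖ ^ 2) disc :=
    (h.memLp_covariantDeriv _ 0).integrable_norm_pow two_ne_zero |>.add
      ((h.memLp_covariantDeriv _ 1).integrable_norm_pow two_ne_zero)
  have i2 : IntegrableOn (fun x => ‖Ψ x‖ ^ 4 / ε ^ 2) disc := by
    refine (h4.integrable_sq.div_const (ε ^ 2)).congr (ae_of_all _ fun x => ?_)
    simp only
    ring
  have i3 := integrableOn_tfEnergy h4 Ω₀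
  have i4 : IntegrableOn (fun x => (Ω₀ / ε) ^ 2 * ‖x‖ ^ 2 * ‖Ψ x‖ ^ 2 / 4) disc := by
    refine (i2.sub (i3.div_const (ε ^ 2))).congr (ae_of_all _ fun x => ?_)
    simp only [Pi.sub_apply]
    ring
  rw [gpEnergy, ← ofReal_integral_eq_lintegral_ofReal i2 (ae_of_all _ fun x => by positivity),
    EReal.coe_ennreal_ofReal, max_eq_left (integral_nonneg fun x => by positivity),
    ← EReal.coe_add]
  congr 1
  simp_rw [norm_sq_sub_angularMomentum]
  rw [integral_sub i1 i4, tfEnergy, ← integral_div, sub_add_eq_add_sub, add_sub_assoc,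
    ← integral_sub i2 i4]
  congr 1
  refine integral_congr_ae (ae_of_all _ fun x => ?_)
  simp only
  ring

/-- The energy excess of a minimizer controls the distance of its density to `rhoTF`. -/
theorem IsGPMinimizer.integral_sq_sub_rhoTF_le {Ω₀ ε : ℝ} (h0 : 0 < Ω₀) (hε : 0 < ε)
    {Ψ : Plane → ℂ} (hΨ : IsGPMinimizer (Ω₀ / ε) ε Ψ) {Φ : Plane → ℂ} {H : Fin 2 → Plane → ℂ}
    (hΦ : IsH1 Φ H) (hΦ1 : ∫ x in disc, ‖Φ x‖ ^ 2 = 1) {B : ℝ}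
    (hB : gpEnergy (Ω₀ / ε) ε Φ H ≤ ((tfEnergy Ω₀ (rhoTF Ω₀) / ε ^ 2 + B : ℝ) : EReal)) :
    MemLp (fun x => ‖Ψ x‖ ^ 2) 2 (volume.restrict disc) ∧
      ∫ x in disc, (‖Ψ x‖ ^ 2 - rhoTF Ω₀ x) ^ 2 ≤ ε ^ 2 * B := by
  obtain ⟨G, hG, hm, hmin⟩ := hΨ
  have h1 := (hmin Φ H hΦ hΦ1).trans hB
  have h4 := hG.memLp_norm_sq hε
    (lintegral_norm_pow_four_ne_top (h1.trans_lt (EReal.coe_lt_top _)).ne)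
  refine ⟨h4, ?_⟩
  rw [hG.gpEnergy_eq hε h4, EReal.coe_le_coe_iff] at h1
  -- For the lower bound the magnetic kinetic energy is simply discarded.
  have h2 : 0 ≤ ∫ x in disc, (‖covariantDeriv (Ω₀ / ε) Ψ G 0 x‖ ^ 2
      + ‖covariantDeriv (Ω₀ / ε) Ψ G 1 x‖ ^ 2) := integral_nonneg fun x => by positivity
  have h3 : (tfEnergy Ω₀ (fun x => ‖Ψ x‖ ^ 2) - tfEnergy Ω₀ (rhoTF Ω₀)) / ε ^ 2 ≤ B := by
    rw [sub_div]; linarith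
  rw [div_le_iff₀' (by positivity)] at h3
  exact (_root_.integral_sq_sub_rhoTF_le h0
    ⟨h4, ae_of_all _ fun x => sq_nonneg _, hm⟩).trans h3

/-! ### The trial state -/

theorem hasLineDerivAt_of_fst {E : Type*} [NormedAddCommGroup E] [NormedSpace ℝ E]
    {W : ℝ → ℝ → E} {x : Plane} {d : E} (h : HasDerivAt (fun s => W s (x 1)) d (x 0)) :
    HasLineDerivAt ℝ (fun x : Plane => W (x 0) (x 1)) d x (EuclideanSpace.single 0 1) := by
  have h1 : HasDerivAt (fun t : ℝ => x 0 + t) 1 0 := by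
    simpa using (hasDerivAt_id (0 : ℝ)).const_add (x 0)
  have h2 : HasDerivAt (fun s => W s (x 1)) d (x 0 + 0) := by simpa using h
  simpa [HasLineDerivAt, Function.comp_def] using h2.scomp (0 : ℝ) h1

theorem hasLineDerivAt_of_snd {E : Type*} [NormedAddCommGroup E] [NormedSpace ℝ E]
    {W : ℝ → ℝ → E} {x : Plane} {d : E} (h : HasDerivAt (fun s => W (x 0) s) d (x 1)) :
    HasLineDerivAt ℝ (fun x : Plane => W (x 0) (x 1)) d x (EuclideanSpace.single 1 1) := by
  have h1 : HasDerivAt (fun t : ℝ => x 1 + t) 1 0 := by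
    simpa using (hasDerivAt_id (0 : ℝ)).const_add (x 1)
  have h2 : HasDerivAt (fun s => W (x 0) s) d (x 1 + 0) := by simpa using h
  simpa [HasLineDerivAt, Function.comp_def] using h2.scomp (0 : ℝ) h1

/-- A state of modulus nearly one with a lattice of vortices which compensates the magnetic field
`Ω₀ / ε`; `h` is the reciprocal of a regularized squared distance to the vortices. -/
theorem exists_vortexState {Ω₀ ε : ℝ} (h0 : 0 < Ω₀) (hε : 0 < ε) (hε1 : ε ≤ 1 / 2)
    (hε2 : 2 * Real.pi * ε ≤ Ω₀) :
    ∃ (v : Plane → ℂ) (h : Plane → ℝ), ContDiff ℝ 1 v ∧ Continuous h ∧ (∀ x, 0 ≤ h x) ∧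
      (∀ x, ‖v x‖ ^ 2 = 1 - ε * h x) ∧
      (∀ x ∈ disc, ∀ i : Fin 2, ‖fderiv ℝ v x (EuclideanSpace.single i 1)
        - Complex.I * (magneticPotential (Ω₀ / ε) i x : ℂ) * v x‖ ^ 2
          ≤ 32 * Real.pi * Ω₀ / ε * h x) ∧
      ∫ x in disc, h x ≤ 32 * Real.pi * |Real.log ε| := by
  have hpi := Real.pi_pos
  -- The spacing is forced by `Ωℓ² = 2π`, which puts one vortex in each cell.
  set ℓ := √(2 * Real.pi * ε / Ω₀) with hℓdef
  have hsq : ℓ ^ 2 = 2 * Real.pi * ε / Ω₀ := Real.sq_sqrt (by positivity)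
  have hℓ : 0 < ℓ := Real.sqrt_pos.2 (by positivity)
  have hℓ1 : ℓ ≤ 1 := Real.sqrt_le_one.2 ((div_le_one h0).2 hε2)
  have hΩ : Ω₀ / ε = 2 * Real.pi / ℓ ^ 2 := by
    rw [hsq]
    field_simp
  obtain ⟨N, hN⟩ := exists_nat_ge (1 / ℓ + 1)
  set w : Plane → ℂ := fun x => vortexLattice (Ω₀ / ε) ℓ N (x 0) (x 1) with hw
  have hwc : ContDiff ℝ 1 w := contDiff_vortexLattice _ _ _
  have hpos : ∀ x, 0 < ‖w x‖ ^ 2 + ε := fun x => by positivity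
  have hvc : ContDiff ℝ 1 fun x => (√(‖w x‖ ^ 2 + ε))⁻¹ • w x := by
    refine ContDiff.smul (ContDiff.inv (ContDiff.sqrt ((hwc.norm_sq ℝ).add contDiff_const)
      fun x => (hpos x).ne') fun x => (Real.sqrt_pos.2 (hpos x)).ne') hwc
  refine ⟨fun x => (√(‖w x‖ ^ 2 + ε))⁻¹ • w x, fun x => (‖w x‖ ^ 2 + ε)⁻¹, hvc,
    Continuous.inv₀ (by have := hwc.continuous; fun_prop) fun x => (hpos x).ne',
    fun x => by positivity, fun x => ?_, fun x hx i => ?_,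
    setIntegral_disc_inv_vortexLattice_le hℓ hℓ1 hN hε hε1⟩
  · have := (hpos x).ne'
    rw [norm_smul, mul_pow, norm_inv, inv_pow, Real.norm_eq_abs, sq_abs,
      Real.sq_sqrt (hpos x).le]
    field_simp
    ring
  · have hx0 : |x 0 / ℓ| + 1 ≤ N := by
      refine le_trans ?_ hN
      rw [abs_div, abs_of_pos hℓ]
      gcongr
      exact ((PiLp.norm_apply_le x 0).trans_lt (norm_lt_one_of_mem_disc hx)).le
    have hd : ∃ d : ℂ, HasLineDerivAt ℝ w d x (EuclideanSpace.single i 1) ∧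
        ‖d - Complex.I * (magneticPotential (Ω₀ / ε) i x : ℂ) * w x‖ ≤ 4 * Real.pi / ℓ := by
      match i with
      | 0 =>
        obtain ⟨d, h1, h2⟩ := exists_hasDerivAt_vortexLattice_fst (Ω := Ω₀ / ε) hℓ hx0 (x 1)
        exact ⟨d, hasLineDerivAt_of_fst h1, h2⟩
      | 1 =>
        obtain ⟨d, h1, h2⟩ := exists_hasDerivAt_vortexLattice_snd hℓ hΩ hx0 (x 1)
        exact ⟨d, hasLineDerivAt_of_snd h1, h2⟩
    obtain ⟨d, h1, h2⟩ := hd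
    obtain ⟨d', h3, h4⟩ := exists_hasDerivAt_normalized h1 hε (magneticPotential (Ω₀ / ε) i x)
    have h5 : HasLineDerivAt ℝ (fun x => (√(‖w x‖ ^ 2 + ε))⁻¹ • w x) d' x
      (EuclideanSpace.single i 1) := h3
    have h6 := ((hvc.differentiable one_ne_zero x).hasFDerivAt.hasLineDerivAt
      (EuclideanSpace.single i 1)).unique h5
    rw [h6]
    simp only [zero_smul, add_zero] at h4
    have h7 : 2 * ‖d - Complex.I * (magneticPotential (Ω₀ / ε) i x : ℂ) * w x‖
        / √(‖w x‖ ^ 2 + ε) ≤ 2 * (4 * Real.pi / ℓ) / √(‖w x‖ ^ 2 + ε) := by gcongr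
    refine (pow_le_pow_left₀ (norm_nonneg _) (h4.trans h7) 2).trans_eq ?_
    have := (hpos x).ne'
    rw [div_pow, mul_pow, div_pow, hsq, Real.sq_sqrt (hpos x).le]
    field_simp
    ring

/-- A Lipschitz square root of `rhoTF + ε` on the disc. -/
noncomputable def tfAmplitude (Ω₀ ε : ℝ) (x : Plane) : ℝ :=
  √(max (tfOffset Ω₀ + Ω₀ ^ 2 / 8 * (min ‖x‖ 1) ^ 2) 0 + ε)

theorem tfAmplitude_sq {Ω₀ ε : ℝ} (h0 : 0 < Ω₀) (hε : 0 < ε) {x : Plane} (hx : x ∈ disc) :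
    tfAmplitude Ω₀ ε x ^ 2 = rhoTF Ω₀ x + ε := by
  rw [tfAmplitude, min_eq_left (norm_lt_one_of_mem_disc hx).le, ← rhoTF_eq h0,
    Real.sq_sqrt (add_nonneg (rhoTF_nonneg h0 x) hε.le)]

theorem abs_sqrt_sub_sqrt_le {a b ε : ℝ} (hε : 0 < ε) (ha : ε ≤ a) (hb : ε ≤ b) :
    |√a - √b| ≤ |a - b| / (2 * √ε) := by
  have hs : 0 < √ε := Real.sqrt_pos.2 hε
  have h1 : √ε ≤ √a := Real.sqrt_le_sqrt ha
  have h2 : √ε ≤ √b := Real.sqrt_le_sqrt hb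
  have h3 : a - b = (√a - √b) * (√a + √b) := by
    have := Real.sq_sqrt (hε.le.trans ha)
    have := Real.sq_sqrt (hε.le.trans hb)
    nlinarith
  rw [le_div_iff₀ (by positivity), h3, abs_mul]
  refine mul_le_mul_of_nonneg_left ?_ (abs_nonneg _)
  exact le_trans (by linarith) (le_abs_self _)

/-- Truncation at `‖x‖ = 1` makes the quadratic profile globally Lipschitz, and the shift by `ε`
bounds the slope of the square root by `1/(2√ε)`. The squared gradient is then `O(1/ε)`, within the
allowed error. -/
theorem lipschitzWith_tfAmplitude (Ω₀ : ℝ) {ε : ℝ} (hε : 0 < ε) :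
    LipschitzWith (Real.toNNReal (Ω₀ ^ 2 / 8 / √ε)) (tfAmplitude Ω₀ ε) := by
  refine LipschitzWith.of_dist_le_mul fun x y => ?_
  have hs : 0 < √ε := Real.sqrt_pos.2 hε
  rw [Real.coe_toNNReal _ (by positivity), Real.dist_eq, tfAmplitude, tfAmplitude]
  set a := min ‖x‖ 1 with ha
  set b := min ‖y‖ 1 with hb
  have ha0 : 0 ≤ a := le_min (norm_nonneg _) zero_le_one
  have hb0 : 0 ≤ b := le_min (norm_nonneg _) zero_le_one
  have hab : |a - b| ≤ dist x y := by
    refine (abs_min_sub_min_le_max _ _ _ _).trans (max_le ?_ ?_)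
    · rw [dist_eq_norm]; exact abs_norm_sub_norm_le x y
    · simp
  have hab2 : |a + b| ≤ 2 := by
    rw [abs_of_nonneg (by positivity)]
    linarith [min_le_right ‖x‖ 1, min_le_right ‖y‖ 1]
  refine (abs_sqrt_sub_sqrt_le hε (le_add_of_nonneg_left (le_max_right _ _))
    (le_add_of_nonneg_left (le_max_right _ _))).trans ?_
  rw [add_sub_add_right_eq_sub]
  have h1 : |max (tfOffset Ω₀ + Ω₀ ^ 2 / 8 * a ^ 2) 0 - max (tfOffset Ω₀ + Ω₀ ^ 2 / 8 * b ^ 2) 0|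
      ≤ Ω₀ ^ 2 / 8 * (dist x y * 2) := by
    refine (abs_max_sub_max_le_abs _ _ _).trans ?_
    rw [add_sub_add_left_eq_sub, ← mul_sub, sq_sub_sq, abs_mul, abs_mul, abs_of_nonneg
      (by positivity : 0 ≤ Ω₀ ^ 2 / 8), mul_comm |a + b|]
    gcongr
  calc _ ≤ Ω₀ ^ 2 / 8 * (dist x y * 2) / (2 * √ε) := by gcongr
    _ = _ := by field_simp

/-- Since `g` is real, the Leibniz rule assigns the magnetic term to `v` alone. -/
theorem norm_sq_covariantDeriv_smul_le (Ω : ℝ) {g : Plane → ℝ} {K : NNReal}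
    (hg : LipschitzWith K g) (v : Plane → ℂ) (i : Fin 2) {x : Plane} (hv : ‖v x‖ ≤ 1) :
    ‖covariantDeriv Ω (fun x => g x • v x) (productGradient g v) i x‖ ^ 2
      ≤ 2 * (K ^ 2 + g x ^ 2 * ‖fderiv ℝ v x (EuclideanSpace.single i 1)
        - Complex.I * (magneticPotential Ω i x : ℂ) * v x‖ ^ 2) := by
  set e : Plane := EuclideanSpace.single i 1
  set D := fderiv ℝ v x e - Complex.I * (magneticPotential Ω i x : ℂ) * v x with hD
  have h1 : covariantDeriv Ω (fun x => g x • v x) (productGradient g v) i x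
      = lineDeriv ℝ g x e • v x + g x • D := by
    simp only [covariantDeriv, productGradient, hD, Complex.real_smul, e]
    ring
  have h2 : ‖lineDeriv ℝ g x e • v x‖ ≤ K := by
    rw [norm_smul]
    have h3 := norm_lineDeriv_le_of_lipschitz ℝ hg (x₀ := x) (v := e)
    have h4 : ‖e‖ = 1 := by simp [e]
    rw [h4, mul_one] at h3
    exact (mul_le_mul h3 hv (norm_nonneg _) K.2).trans_eq (mul_one _)
  rw [h1]
  have h3 := norm_add_le (lineDeriv ℝ g x e • v x) (g x • D)
  have h4 : ‖g x • D‖ ^ 2 = g x ^ 2 * ‖D‖ ^ 2 := by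
    rw [norm_smul, mul_pow, Real.norm_eq_abs, sq_abs]
  have h5 : ‖lineDeriv ℝ g x e • v x‖ ^ 2 ≤ K ^ 2 := by gcongr
  calc _ ≤ (‖lineDeriv ℝ g x e • v x‖ + ‖g x • D‖) ^ 2 := by gcongr
    _ ≤ 2 * (‖lineDeriv ℝ g x e • v x‖ ^ 2 + ‖g x • D‖ ^ 2) := add_sq_le
    _ ≤ _ := by rw [h4]; gcongr

theorem rhoTF_le {Ω₀ : ℝ} (h0 : 0 < Ω₀) {x : Plane} (hx : x ∈ disc) :
    rhoTF Ω₀ x ≤ |tfOffset Ω₀| + Ω₀ ^ 2 / 8 := by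
  have h1 : ‖x‖ ^ 2 ≤ 1 := pow_le_one₀ (norm_nonneg x) (norm_lt_one_of_mem_disc hx).le
  rw [rhoTF_eq h0]
  refine max_le ?_ (by positivity)
  have := le_abs_self (tfOffset Ω₀)
  have : Ω₀ ^ 2 / 8 * ‖x‖ ^ 2 ≤ Ω₀ ^ 2 / 8 * 1 := by gcongr
  linarith

/-- The Thomas-Fermi functional is Lipschitz for the `L¹` distance on bounded densities. -/
theorem tfEnergy_sub_le {Ω₀ S : ℝ} (h0 : 0 < Ω₀) {σ : Plane → ℝ} (hσ : Continuous σ)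
    (hσ0 : ∀ x ∈ disc, 0 ≤ σ x) (hσS : ∀ x ∈ disc, σ x ≤ S) :
    tfEnergy Ω₀ σ - tfEnergy Ω₀ (rhoTF Ω₀)
      ≤ (S + |tfOffset Ω₀| + 3 * (Ω₀ ^ 2 / 8)) * ∫ x in disc, |σ x - rhoTF Ω₀ x| := by
  have hρ := continuous_rhoTF h0
  have i1 := integrableOn_tfEnergy (hσ.memLp_disc 2) Ω₀
  have i2 := integrableOn_tfEnergy (hρ.memLp_disc 2) Ω₀
  have i3 : IntegrableOn (fun x => |σ x - rhoTF Ω₀ x|) disc :=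
    Continuous.integrableOn_disc (by fun_prop)
  rw [tfEnergy, tfEnergy, ← integral_sub i1 i2, ← integral_const_mul]
  refine setIntegral_mono_on (i1.sub i2) (i3.const_mul _) measurableSet_disc fun x hx => ?_
  have h1 : ‖x‖ ^ 2 ≤ 1 := pow_le_one₀ (norm_nonneg x) (norm_lt_one_of_mem_disc hx).le
  have h2 : Ω₀ ^ 2 / 8 * ‖x‖ ^ 2 ≤ Ω₀ ^ 2 / 8 * 1 := by gcongr
  have h2' : 0 ≤ Ω₀ ^ 2 / 8 * ‖x‖ ^ 2 := by positivity
  have h3 := rhoTF_le h0 hx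
  have h4 := rhoTF_nonneg h0 x
  have h5 := hσ0 x hx
  have h6 := hσS x hx
  have h7 : |σ x + rhoTF Ω₀ x - 2 * (Ω₀ ^ 2 / 8 * ‖x‖ ^ 2)|
      ≤ S + |tfOffset Ω₀| + 3 * (Ω₀ ^ 2 / 8) := by
    have := abs_nonneg (tfOffset Ω₀)
    rw [abs_le]
    constructor <;> linarith
  calc _ = (σ x + rhoTF Ω₀ x - 2 * (Ω₀ ^ 2 / 8 * ‖x‖ ^ 2)) * (σ x - rhoTF Ω₀ x) := by ring
    _ ≤ |σ x + rhoTF Ω₀ x - 2 * (Ω₀ ^ 2 / 8 * ‖x‖ ^ 2)| * |σ x - rhoTF Ω₀ x| := by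
        rw [← abs_mul]; exact le_abs_self _
    _ ≤ _ := by gcongr

/-- The bound for the density of the trial state before normalization. -/
theorem integral_abs_trialDensity_sub_le {Ω₀ ε : ℝ} (h0 : 0 < Ω₀) (hε : 0 < ε)
    (hL : 1 ≤ |Real.log ε|) {h : Plane → ℝ} (hc : Continuous h) (hh : ∀ x, 0 ≤ h x)
    (hh1 : ∀ x, 0 ≤ 1 - ε * h x) (hhI : ∫ x in disc, h x ≤ 32 * Real.pi * |Real.log ε|) :
    ∫ x in disc, |(rhoTF Ω₀ x + ε) * (1 - ε * h x) - rhoTF Ω₀ x|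
      ≤ (Real.pi + 32 * Real.pi * (|tfOffset Ω₀| + Ω₀ ^ 2 / 8)) * (ε * |Real.log ε|) := by
  have hρ := continuous_rhoTF h0
  set M := |tfOffset Ω₀| + Ω₀ ^ 2 / 8 with hM
  have hM0 : 0 ≤ M := by positivity
  have i1 : IntegrableOn (fun x => |(rhoTF Ω₀ x + ε) * (1 - ε * h x) - rhoTF Ω₀ x|) disc :=
    Continuous.integrableOn_disc (by fun_prop)
  have i2 : IntegrableOn (fun _ : Plane => ε) disc := Continuous.integrableOn_disc (by fun_prop)
  have i3 : IntegrableOn (fun x => M * ε * h x) disc := Continuous.integrableOn_disc (by fun_prop)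
  calc _ ≤ ∫ x in disc, (ε + M * ε * h x) := by
        -- The difference equals `ε(1 - εh) - εh * rhoTF`, a regularization error and a vortex-core
        -- error.
        refine setIntegral_mono_on i1 (i2.add i3) measurableSet_disc fun x hx => ?_
        have h1 : rhoTF Ω₀ x * (ε * h x) ≤ M * (ε * h x) :=
          mul_le_mul_of_nonneg_right (rhoTF_le h0 hx) (mul_nonneg hε.le (hh x))
        have h2 := mul_nonneg (rhoTF_nonneg h0 x) (mul_nonneg hε.le (hh x))
        have h3 := mul_nonneg hε.le (hh1 x)
        have h4 := mul_nonneg hε.le (mul_nonneg hε.le (hh x))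
        have h5 := mul_nonneg hM0 (mul_nonneg hε.le (hh x))
        rw [abs_le]
        constructor <;> nlinarith
    _ = ε * Real.pi + M * ε * ∫ x in disc, h x := by
        rw [integral_add i2 i3, integral_const_mul, setIntegral_const, volume_real_disc,
          smul_eq_mul, mul_comm]
    _ ≤ ε * (Real.pi * |Real.log ε|) + M * ε * (32 * Real.pi * |Real.log ε|) := by
        gcongr
        exact le_mul_of_one_le_right Real.pi_pos.le hL
    _ = _ := by ring

/-- The state is `√((rhoTF + ε)/n) v` on the disc, with `n` the mass before normalization. The last
smallness condition gives `n ≥ 1/2`, and `1 ≤ |log ε|` absorbs the errors that carry no logarithm.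
-/
theorem exists_trialState {Ω₀ : ℝ} (h0 : 0 < Ω₀) : ∃ B : ℝ, 0 < B ∧ ∀ ε : ℝ, 0 < ε → ε ≤ 1 / 2 →
    2 * Real.pi * ε ≤ Ω₀ → 1 ≤ |Real.log ε| →
    (Real.pi + 32 * Real.pi * (|tfOffset Ω₀| + Ω₀ ^ 2 / 8)) * (ε * |Real.log ε|) ≤ 1 / 2 →
    ∃ (Φ : Plane → ℂ) (H : Fin 2 → Plane → ℂ), IsH1 Φ H ∧ ∫ x in disc, ‖Φ x‖ ^ 2 = 1 ∧
      gpEnergy (Ω₀ / ε) ε Φ H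
        ≤ ((tfEnergy Ω₀ (rhoTF Ω₀) / ε ^ 2 + B * |Real.log ε| / ε : ℝ) : EReal) := by
  have hpi := Real.pi_pos
  set β := Ω₀ ^ 2 / 8 with hβ
  have hβ0 : 0 < β := by positivity
  set M := |tfOffset Ω₀| + β with hM
  have hM0 : 0 < M := by positivity
  set D := Real.pi + 32 * Real.pi * M with hD
  have hD0 : 0 < D := by positivity
  set S := 2 * (M + 1) with hS
  -- Kinetic constant: `8` collects the square of a sum, `c² ≤ 2` and the two components; `1024π²`
  -- is the `32π` of the gradient bound times the `32π` of `∫ h`.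
  set B₁ := 8 * (β ^ 2 * Real.pi + 1024 * Real.pi ^ 2 * Ω₀ * (M + 1)) with hB₁
  -- Potential constant: the `L¹`-Lipschitz constant of the functional times an `L¹` error, in which
  -- the unnormalized density and the normalization each contribute `2D`.
  set B₂ := (S + |tfOffset Ω₀| + 3 * β) * (4 * D) with hB₂
  refine ⟨B₁ + B₂, by positivity, fun ε hε hε1 hε2 hL hDε => ?_⟩
  set L := |Real.log ε| with hLdef
  obtain ⟨v, h, hv, hc, hh, hvh, hDv, hhI⟩ := exists_vortexState h0 hε hε1 hε2
  have hρ := continuous_rhoTF h0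
  have hh1 : ∀ x, 0 ≤ 1 - ε * h x := fun x => by rw [← hvh]; positivity
  have hh2 : ∀ x, 1 - ε * h x ≤ 1 := fun x => by linarith [mul_nonneg hε.le (hh x)]
  have hv1 : ∀ x, ‖v x‖ ≤ 1 := fun x => by
    rw [← sq_le_one_iff₀ (norm_nonneg _), hvh]; exact hh2 x
  have hvc := hv.continuous
  have hg := lipschitzWith_tfAmplitude Ω₀ hε
  have hI := integral_abs_trialDensity_sub_le h0 hε hL hc hh hh1 hhI
  set τ : Plane → ℝ := fun x => (rhoTF Ω₀ x + ε) * (1 - ε * h x) with hτ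
  have hτc : Continuous τ := by fun_prop
  set n := ∫ x in disc, τ x with hn
  have hn1 : |n - 1| ≤ D * (ε * L) := by
    have e : n - 1 = ∫ x in disc, (τ x - rhoTF Ω₀ x) := by
      rw [integral_sub hτc.integrableOn_disc hρ.integrableOn_disc, integral_rhoTF h0]
    rw [e]
    exact abs_integral_le_integral_abs.trans hI
  have hn2 : 1 / 2 ≤ n := by linarith [(abs_le.1 hn1).1]
  have hn0 : 0 < n := by linarith
  set c := (√n)⁻¹ with hcdef
  have hc0 : 0 < c := inv_pos.2 (Real.sqrt_pos.2 hn0)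
  have hcsq : c ^ 2 = n⁻¹ := by rw [hcdef, inv_pow, Real.sq_sqrt hn0.le]
  have hc2 : c ^ 2 ≤ 2 := by
    rw [hcsq]
    exact (inv_anti₀ (by norm_num) hn2).trans_eq (by norm_num)
  have hs : 0 < √ε := Real.sqrt_pos.2 hε
  have hcg : LipschitzWith (Real.toNNReal (c * (β / √ε))) fun x => c * tfAmplitude Ω₀ ε x := by
    refine LipschitzWith.of_dist_le_mul fun x y => ?_
    have h1 := hg.dist_le_mul x y
    rw [Real.coe_toNNReal _ (by positivity)] at h1 ⊢
    rw [Real.dist_eq] at h1 ⊢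
    rw [← mul_sub, abs_mul, abs_of_pos hc0, mul_assoc]
    gcongr
  have hΦ := isH1_smul hcg hv
  have hΦsq : ∀ x ∈ disc, ‖(c * tfAmplitude Ω₀ ε x) • v x‖ ^ 2 = n⁻¹ * τ x := by
    intro x hx
    rw [norm_smul, mul_pow, Real.norm_eq_abs, sq_abs, mul_pow, hcsq, tfAmplitude_sq h0 hε hx, hvh]
    ring
  have hΦc : Continuous fun x => ‖(c * tfAmplitude Ω₀ ε x) • v x‖ ^ 2 :=
    ((hcg.continuous.smul hvc).norm).pow 2
  refine ⟨_, _, hΦ, ?_, ?_⟩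
  · rw [setIntegral_congr_fun measurableSet_disc hΦsq, integral_const_mul]
    exact inv_mul_cancel₀ hn0.ne'
  rw [hΦ.gpEnergy_eq hε (hΦc.memLp_disc 2), EReal.coe_le_coe_iff]
  have hτM : ∀ x ∈ disc, rhoTF Ω₀ x + ε ≤ M + 1 := fun x hx => by linarith [rhoTF_le h0 hx]
  have hτ0 : ∀ x, 0 ≤ τ x := fun x =>
    mul_nonneg (add_nonneg (rhoTF_nonneg h0 x) hε.le) (hh1 x)
  have kinetic : ∫ x in disc, (‖covariantDeriv (Ω₀ / ε) (fun x => (c * tfAmplitude Ω₀ ε x) • v x)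
      (productGradient (fun x => c * tfAmplitude Ω₀ ε x) v) 0 x‖ ^ 2
      + ‖covariantDeriv (Ω₀ / ε) (fun x => (c * tfAmplitude Ω₀ ε x) • v x)
      (productGradient (fun x => c * tfAmplitude Ω₀ ε x) v) 1 x‖ ^ 2) ≤ B₁ * L / ε := by
    have pw : ∀ x ∈ disc, ∀ i, ‖covariantDeriv (Ω₀ / ε) (fun x => (c * tfAmplitude Ω₀ ε x) • v x)
        (productGradient (fun x => c * tfAmplitude Ω₀ ε x) v) i x‖ ^ 2
        ≤ 4 / ε * (β ^ 2 + 32 * Real.pi * Ω₀ * (M + 1) * h x) := by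
      intro x hx i
      refine (norm_sq_covariantDeriv_smul_le (Ω₀ / ε) hcg v i (hv1 x)).trans ?_
      rw [Real.coe_toNNReal _ (by positivity), mul_pow, mul_pow, div_pow, Real.sq_sqrt hε.le,
        tfAmplitude_sq h0 hε hx]
      have h1 := hτM x hx
      have h2 := hDv x hx i
      have h3 : 0 ≤ rhoTF Ω₀ x + ε := add_nonneg (rhoTF_nonneg h0 x) hε.le
      calc _ ≤ 2 * (2 * (β ^ 2 / ε) + 2 * (M + 1) * (32 * Real.pi * Ω₀ / ε * h x)) := by gcongr
        _ = _ := by field_simp; ring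
    have i0 : ∀ i, IntegrableOn (fun x => ‖covariantDeriv (Ω₀ / ε)
        (fun x => (c * tfAmplitude Ω₀ ε x) • v x)
        (productGradient (fun x => c * tfAmplitude Ω₀ ε x) v) i x‖ ^ 2) disc :=
      fun i => (hΦ.memLp_covariantDeriv _ i).integrable_norm_pow two_ne_zero
    have i1 : IntegrableOn (fun _ : Plane => β ^ 2) disc :=
      Continuous.integrableOn_disc (by fun_prop)
    have i2 : IntegrableOn (fun x => 32 * Real.pi * Ω₀ * (M + 1) * h x) disc :=
      Continuous.integrableOn_disc (by fun_prop)
    calc _ ≤ ∫ x in disc, 8 / ε * (β ^ 2 + 32 * Real.pi * Ω₀ * (M + 1) * h x) := by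
          refine setIntegral_mono_on ((i0 0).add (i0 1)) ((i1.add i2).const_mul _)
            measurableSet_disc fun x hx => (add_le_add (pw x hx 0) (pw x hx 1)).trans_eq ?_
          ring
      _ = 8 / ε * (β ^ 2 * Real.pi + 32 * Real.pi * Ω₀ * (M + 1) * ∫ x in disc, h x) := by
          rw [integral_const_mul, integral_add i1 i2, integral_const_mul, setIntegral_const,
            volume_real_disc, smul_eq_mul, mul_comm Real.pi]
      _ ≤ 8 / ε * (β ^ 2 * (Real.pi * L)
            + 32 * Real.pi * Ω₀ * (M + 1) * (32 * Real.pi * L)) := by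
          gcongr
          exact le_mul_of_one_le_right hpi.le hL
      _ = _ := by rw [hB₁]; ring
  have dist : ∫ x in disc, |‖(c * tfAmplitude Ω₀ ε x) • v x‖ ^ 2 - rhoTF Ω₀ x|
      ≤ 4 * D * (ε * L) := by
    have j1 : IntegrableOn (fun x => |τ x - rhoTF Ω₀ x|) disc :=
      Continuous.integrableOn_disc (by fun_prop)
    calc _ ≤ ∫ x in disc, (n⁻¹ * |τ x - rhoTF Ω₀ x| + |n⁻¹ - 1| * rhoTF Ω₀ x) := by
          refine setIntegral_mono_on (Continuous.integrableOn_disc (by fun_prop))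
            ((j1.const_mul _).add (hρ.integrableOn_disc.const_mul _)) measurableSet_disc
            fun x hx => ?_
          rw [hΦsq x hx, show n⁻¹ * τ x - rhoTF Ω₀ x
            = n⁻¹ * (τ x - rhoTF Ω₀ x) + (n⁻¹ - 1) * rhoTF Ω₀ x by ring]
          refine (abs_add_le _ _).trans_eq ?_
          rw [abs_mul, abs_mul, abs_of_pos (inv_pos.2 hn0), abs_of_nonneg (rhoTF_nonneg h0 x)]
      _ = n⁻¹ * (∫ x in disc, |τ x - rhoTF Ω₀ x|) + |n⁻¹ - 1| := by
          rw [integral_add (j1.const_mul _) (hρ.integrableOn_disc.const_mul _),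
            integral_const_mul, integral_const_mul, integral_rhoTF h0, mul_one]
      _ ≤ 2 * (D * (ε * L)) + 2 * (D * (ε * L)) := by
          have e : |n⁻¹ - 1| = n⁻¹ * |n - 1| := by
            rw [← abs_of_pos (inv_pos.2 hn0), ← abs_mul, abs_of_pos (inv_pos.2 hn0), abs_sub_comm,
              mul_sub, inv_mul_cancel₀ hn0.ne', mul_one]
          rw [e, ← hcsq]
          gcongr
      _ = _ := by ring
  have potential := tfEnergy_sub_le (S := S) h0 hΦc (fun x _ => by positivity) fun x hx => by
    rw [hΦsq x hx, ← hcsq]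
    have h1 : τ x ≤ (M + 1) * 1 := mul_le_mul (hτM x hx) (hh2 x) (hh1 x) (by positivity)
    calc c ^ 2 * τ x ≤ 2 * ((M + 1) * 1) := mul_le_mul hc2 h1 (hτ0 x) zero_le_two
      _ = S := by rw [hS]; ring
  have potential' : tfEnergy Ω₀ (fun x => ‖(c * tfAmplitude Ω₀ ε x) • v x‖ ^ 2)
      ≤ tfEnergy Ω₀ (rhoTF Ω₀) + B₂ * (ε * L) := by
    have : (S + |tfOffset Ω₀| + 3 * β)
        * ∫ x in disc, |‖(c * tfAmplitude Ω₀ ε x) • v x‖ ^ 2 - rhoTF Ω₀ x|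
        ≤ (S + |tfOffset Ω₀| + 3 * β) * (4 * D * (ε * L)) := by gcongr
    rw [← hβ] at potential
    rw [hB₂]
    linarith
  calc _ ≤ B₁ * L / ε + (tfEnergy Ω₀ (rhoTF Ω₀) + B₂ * (ε * L)) / ε ^ 2 := by gcongr
    _ = _ := by field_simp; ring

/-! ### The main theorem -/

/-- Pointwise `|f| ≤ f²/(2√t) + √t/2` plays the role of Cauchy–Schwarz on the disc of area `π`. -/
theorem integral_abs_le_of_integral_sq_le {f : Plane → ℝ} (hf : MemLp f 2 (volume.restrict disc))
    {K t : ℝ} (ht : 0 < t) (hK : ∫ x in disc, f x ^ 2 ≤ K * t) :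
    ∫ x in disc, |f x| ≤ (K + Real.pi) / 2 * √t := by
  have hs : 0 < √t := Real.sqrt_pos.2 ht
  have hsq : √t ^ 2 = t := Real.sq_sqrt ht.le
  have i1 : IntegrableOn (fun x => (2 * √t)⁻¹ * f x ^ 2) disc := hf.integrable_sq.const_mul _
  have i2 : IntegrableOn (fun _ : Plane => √t / 2) disc :=
    Continuous.integrableOn_disc (by fun_prop)
  calc ∫ x in disc, |f x| ≤ ∫ x in disc, ((2 * √t)⁻¹ * f x ^ 2 + √t / 2) := by
        refine integral_mono (hf.integrable one_le_two).abs (i1.add i2) fun x => ?_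
        have : (2 * √t)⁻¹ * f x ^ 2 + √t / 2 - |f x| = (2 * √t)⁻¹ * (|f x| - √t) ^ 2 := by
          rw [sub_sq, sq_abs]
          field_simp
          ring
        have h2 : 0 ≤ (2 * √t)⁻¹ * (|f x| - √t) ^ 2 := by positivity
        simp only
        linarith
    _ = (2 * √t)⁻¹ * (∫ x in disc, f x ^ 2) + Real.pi * (√t / 2) := by
        rw [integral_add i1 i2, integral_const_mul, setIntegral_const, volume_real_disc,
          smul_eq_mul]
    _ ≤ (2 * √t)⁻¹ * (K * √t ^ 2) + Real.pi * (√t / 2) := by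
        rw [hsq]
        gcongr
    _ = _ := by field_simp

theorem exists_pos_forall_small {Ω₀ D : ℝ} (h0 : 0 < Ω₀) : ∃ ε₀ : ℝ, 0 < ε₀ ∧ ∀ ε : ℝ, 0 < ε →
    ε < ε₀ → ε ≤ 1 / 2 ∧ 2 * Real.pi * ε ≤ Ω₀ ∧ 1 ≤ |Real.log ε| ∧
      D * (ε * |Real.log ε|) ≤ 1 / 2 := by
  have l1 : Filter.Tendsto (fun ε : ℝ => ε) (𝓝[>] 0) (𝓝 0) :=
    Filter.tendsto_id.mono_left nhdsWithin_le_nhds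
  have l2 : Filter.Tendsto (fun ε : ℝ => 2 * Real.pi * ε) (𝓝[>] 0) (𝓝 0) := by
    simpa using l1.const_mul (2 * Real.pi)
  have l3 : Filter.Tendsto (fun ε : ℝ => |Real.log ε|) (𝓝[>] 0) Filter.atTop :=
    Filter.tendsto_abs_atBot_atTop.comp Real.tendsto_log_nhdsGT_zero
  have l4 : Filter.Tendsto (fun ε : ℝ => D * |Real.log ε * ε|) (𝓝[>] 0) (𝓝 0) := by
    have h : Filter.Tendsto (fun ε : ℝ => ε * Real.log ε) (𝓝[>] 0) (𝓝 0) := by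
      simpa using (Real.continuous_mul_log.tendsto 0).mono_left nhdsWithin_le_nhds
    simpa [mul_comm] using h.abs.const_mul D
  have ev : ∀ᶠ ε : ℝ in 𝓝[>] 0, ε ≤ 1 / 2 ∧ 2 * Real.pi * ε ≤ Ω₀ ∧ 1 ≤ |Real.log ε| ∧
      D * (ε * |Real.log ε|) ≤ 1 / 2 := by
    filter_upwards [l1.eventually (ge_mem_nhds (by norm_num : (0 : ℝ) < 1 / 2)),
      l2.eventually (ge_mem_nhds h0), l3.eventually_ge_atTop 1,
      l4.eventually (ge_mem_nhds (by norm_num : (0 : ℝ) < 1 / 2)), self_mem_nhdsWithin]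
      with ε e1 e2 e3 e4 e5
    refine ⟨e1, e2, e3, ?_⟩
    rwa [abs_mul, abs_of_pos (show 0 < ε from e5), mul_comm |Real.log ε|] at e4
  obtain ⟨ε₀, h1, h2⟩ := mem_nhdsGT_iff_exists_Ioo_subset.1 ev
  exact ⟨ε₀, h1, fun ε e1 e2 => h2 ⟨e1, e2⟩⟩

theorem mainTheorem4 (Ω₀ : ℝ) (hΩ₀ : 0 < Ω₀) :
    -- the explicit density is the unique minimizer of the Thomas-Fermi functional
    (IsTFMinimizer Ω₀ (rhoTF Ω₀) ∧
      ∀ ρ : Plane → ℝ, IsTFMinimizer Ω₀ ρ → ρ =ᵐ[volume.restrict disc] rhoTF Ω₀) ∧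
    -- above the critical value it has a hole
    (4 / √Real.pi < Ω₀ →
      0 < holeRadius Ω₀ ∧ holeRadius Ω₀ < 1 ∧
        ∀ x ∈ disc, rhoTF Ω₀ x = 0 ↔ ‖x‖ ≤ holeRadius Ω₀) ∧
    -- every minimizer of the Gross-Pitaevskii functional has a density close to it
    ∃ C : ℝ, 0 < C ∧ ∃ ε₀ : ℝ, 0 < ε₀ ∧ ∀ ε : ℝ, 0 < ε → ε < ε₀ →
      ∀ Ψ : Plane → ℂ, IsGPMinimizer (Ω₀ / ε) ε Ψ →
        eLpNorm (fun x => ‖Ψ x‖ ^ 2 - rhoTF Ω₀ x) 1 (volume.restrict disc)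
          ≤ ENNReal.ofReal (C * √(ε * |Real.log ε|)) := by
  refine ⟨⟨isTFMinimizer_rhoTF hΩ₀, fun ρ hρ => hρ.ae_eq_rhoTF hΩ₀⟩, fun h =>
    ⟨(holeRadius_mem hΩ₀ h).1, (holeRadius_mem hΩ₀ h).2, fun x _ => rhoTF_eq_zero_iff hΩ₀ h x⟩, ?_⟩
  obtain ⟨B, hB, htrial⟩ := exists_trialState hΩ₀
  obtain ⟨ε₀, hε₀, hsmall⟩ := exists_pos_forall_small
    (D := Real.pi + 32 * Real.pi * (|tfOffset Ω₀| + Ω₀ ^ 2 / 8)) hΩ₀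
  have hpi := Real.pi_pos
  refine ⟨(B + Real.pi) / 2, by positivity, ε₀, hε₀, fun ε hε hεε₀ Ψ hΨ => ?_⟩
  obtain ⟨s1, s2, s3, s4⟩ := hsmall ε hε hεε₀
  obtain ⟨Φ, H, hΦ, hΦ1, hE⟩ := htrial ε hε s1 s2 s3 s4
  obtain ⟨h4, hsq⟩ := hΨ.integral_sq_sub_rhoTF_le hΩ₀ hε hΦ hΦ1 hE
  have hmem : MemLp (fun x => ‖Ψ x‖ ^ 2 - rhoTF Ω₀ x) 2 (volume.restrict disc) :=
    h4.sub (isTFDensity_rhoTF hΩ₀).memLp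
  -- The rate arises here: `ε²` times the energy excess `B|log ε|/ε`.
  have hsq' : ∫ x in disc, (‖Ψ x‖ ^ 2 - rhoTF Ω₀ x) ^ 2 ≤ B * (ε * |Real.log ε|) := by
    refine hsq.trans_eq ?_
    field_simp
  have hfin := integral_abs_le_of_integral_sq_le hmem
    (mul_pos hε (zero_lt_one.trans_le s3)) hsq'
  rw [eLpNorm_one_eq_lintegral_enorm,
    ← ofReal_integral_norm_eq_lintegral_enorm (hmem.integrable one_le_two)]
  exact ENNReal.ofReal_le_ofReal hfin
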